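/- Let $n\ge 1$. For $m\ge 1$ let $W_m$ be the Weyl group of type $A_m$ with simple reflections $s_1,\dots,s_m$ and longest element ${}_mw_0$. For a word $\mathbf i$ in $\{1,\dots,m\}$ let $[\mathbf i]$ be its commutation class (all words obtained from $\mathbf i$ by relations $ij=ji$, $|i-j|\ge 2$), and put $i^*=m+1-i$. The r-cluster point $[\![\mathbf i]\!]$ of a reduced expression $\mathbf i$ of ${}_mw_0$ is the set of classes obtained from $[\mathbf i]$ by finitely many moves $[i_1i_2\cdots i_N]\mapsto[i_2\cdots i_Ni_1^*]$ and $[i_1\cdots i_{N-1}i_N]\mapsto[i_N^*i_1\cdots i_{N-1}]$. In type $A_{2n+1}$ let $i^\vee=2n+2-i$, let $\vee$ act letterwise on words, and let $\mathbf i^{k\vee}$ be the result of applying it $k$ times. A twisted Coxeter element $[i_1\cdots i_{n+1}]\vee$ is given by a word consisting of exactly one letter from each $\vee$-orbit, in any order. Let $[\![Q^\diamondsuit]\!]$ be the r-cluster point of $\prod_{k=0}^{2n}(1\,2\cdots n{+}1)^{k\vee}$. Let $\mathbf P$ be the monoid homomorphism from words in $\{1,\dots,2n+1\}$ to words in $\{1,\dots,2n\}$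 with $\mathbf P(i)=i$ for $i\le n$, $\mathbf P(n+1)$ the empty word, and $\mathbf P(j)=j-1$ for $j\ge n+2$. A Dynkin quiver $Q'$ of type $A_{2n}$ is an orientation of the diagram $1-2-\cdots-2n$. A word $i_1\cdots i_l$ is adapted to $Q'$ if each $i_k$ is a sink of the quiver obtained from $Q'$ by successively reversing all arrows at $i_1,\dots,i_{k-1}$; let $[Q']$ be the set of reduced expressions of ${}_{2n}w_0$ adapted to $Q'$. For a vertex $i$ of $Q'$ let $a_i$ (resp. $b_i$) be the number of arrows between $i$ and $2n+1-i$ directed toward $i$ (resp. toward $2n+1-i$), and let $\mathbf Q$ be the set of Dynkin quivers $Q'$ of type $A_{2n}$ with $|a_i-b_i|=1$ for all $i\in\{1,\dots,2n\}$. (1) For every twisted Coxeter element $[i_1\cdots i_{n+1}]\vee$ of type $A_{2n+1}$, the word $\prod_{k=0}^{2n}(i_1\cdots i_{n+1})^{k\vee}$ is a reduced expression of ${}_{2n+1}w_0$, and its commutation class belongs to $[\![Q^\diamondsuit]\!]$. (2) Let $\Omega$ be the set of all the commutation classes occurring in (1). For $[\mathbf i]\in\Omega$ the class $[\mathbf P(\mathbf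 i)]$ does not depend on the choice of $\mathbf i$ in its class, and $[\mathbf i]\mapsto[\mathbf P(\mathbf i)]$ maps $\Omega$ onto $\{[Q'] : Q'\in\mathbf Q\}$, every $[Q']$ with $Q'\in\mathbf Q$ having exactly two preimages in $\Omega$. Moreover $Q'\mapsto[Q']$ is injective on $\mathbf Q$, and $|\mathbf Q|=2\cdot 3^{n-1}$. -/

import Mathlib

/-- `ω` is a reduced expression of the longest element `w₀` (the element of maximal length) of the
Weyl group of type `A_m`. The vertex `i` of the diagram `A_m` is `i - 1 : Fin m`. -/
def IsReducedWordOfLongest {m : ℕ} (ω : List (Fin m)) : Prop :=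
  (CoxeterMatrix.A m).toCoxeterSystem.IsReduced ω ∧
    ∀ v : (CoxeterMatrix.A m).Group,
      (CoxeterMatrix.A m).toCoxeterSystem.length v ≤
        (CoxeterMatrix.A m).toCoxeterSystem.length
          ((CoxeterMatrix.A m).toCoxeterSystem.wordProd ω)

/-- One application of a commutation relation `s_i s_j = s_j s_i` inside a word of type `A_m`. -/
inductive CommStep {m : ℕ} : List (Fin m) → List (Fin m) → Prop
  | swap (u v : List (Fin m)) (i j : Fin m) (h : CoxeterMatrix.A m i j = 2) :
      CommStep (u ++ i :: j :: v) (u ++ j :: i :: v)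

/-- The commutation class `[ω]`: all words obtained from `ω` by commutation relations only. -/
def commClass {m : ℕ} (ω : List (Fin m)) : Set (List (Fin m)) :=
  {η | Relation.EqvGen CommStep ω η}

/-- A nontrivial application of a reflection functor to a commutation class. In type `A_m` the
involution `*` induced by `w₀` is `i ↦ m + 1 - i`, which is `Fin.rev`.
`right`: `i` is a sink of `[i ω]` and `[i ω] r_i = [ω i*]`.
`left`: `i` is a source of `[ω i]` and `r_i [ω i] = [i* ω]`.
(A functor at an index that is not a sink, respectively a source, fixes the class.) -/
inductive ReflectionStep {m : ℕ} : Set (List (Fin m)) → Set (List (Fin m)) → Prop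
  | right (i : Fin m) (ω : List (Fin m)) :
      ReflectionStep (commClass (i :: ω)) (commClass (ω ++ [i.rev]))
  | left (i : Fin m) (ω : List (Fin m)) :
      ReflectionStep (commClass (ω ++ [i])) (commClass (i.rev :: ω))

/-- The r-cluster point `[[ω]]` of a reduced word `ω` of `w₀`: all commutation classes obtained
from `[ω]` by sequences of reflection functors. -/
def rClusterPoint {m : ℕ} (ω : List (Fin m)) : Set (Set (List (Fin m))) :=
  {C | Relation.ReflTransGen ReflectionStep (commClass ω) C}

/-- The word `∏_{k=0}^{2n} ω^{k∨}` of type `A_{2n+1}`, where `∨` acts on letters by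
`i ↦ 2n + 2 - i`, which is `Fin.rev`. -/
def twistedProduct (n : ℕ) (ω : List (Fin (2 * n + 1))) : List (Fin (2 * n + 1)) :=
  (List.range (2 * n + 1)).flatMap fun k => ω.map (Fin.rev^[k])

/-- The twisted adapted cluster point `[[Q^♢]]` of type `A_{2n+1}`: the r-cluster point of
`∏_{k=0}^{2n} (1 2 ⋯ n+1)^{k∨}`. -/
def twistedAdaptedCluster (n : ℕ) : Set (Set (List (Fin (2 * n + 1)))) :=
  rClusterPoint (twistedProduct n
    (List.ofFn fun j : Fin (n + 1) => Fin.castLE (by omega : n + 1 ≤ 2 * n + 1) j))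

/-- The word `ω = i_1 ⋯ i_{n+1}` gives a twisted Coxeter element `s_{i_1} ⋯ s_{i_{n+1}} ∨` of type
`A_{2n+1}`: it consists of exactly one letter from each orbit `{j, j^∨}`, in any order. -/
def IsTwistedCoxeterWord (n : ℕ) (ω : List (Fin (2 * n + 1))) : Prop :=
  ∀ j : Fin (2 * n + 1), ω.countP (fun k => decide (k = j ∨ k = j.rev)) = 1

/-- The set `Ω` of commutation classes `[∏_{k=0}^{2n} ω^{k∨}]`, for all twisted Coxeter elements
`[ω]∨` of type `A_{2n+1}`. -/
def twistedCoxeterClasses (n : ℕ) : Set (Set (List (Fin (2 * n + 1)))) :=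
  {C | ∃ ω, IsTwistedCoxeterWord n ω ∧ C = commClass (twistedProduct n ω)}

/-- The monoid homomorphism `P` from words of type `A_{2n+1}` to words of type `A_{2n}` with
`P(i) = i` for `i ≤ n`, `P(n+1) = id` and `P(j) = j - 1` for `j ≥ n + 2`. -/
def foldWord (n : ℕ) (ω : List (Fin (2 * n + 1))) : List (Fin (2 * n)) :=
  ω.filterMap fun i =>
    if h : i.val < n then some ⟨i.val, by omega⟩
    else if h' : i.val = n then none
    else some ⟨i.val - 1, by have := i.isLt; omega⟩

/-- The map induced by `P` on commutation classes, `C ↦ ⋃_{ω ∈ C} [P(ω)]`; this is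
`[ω] ↦ [P(ω)]` whenever the latter does not depend on the choice of `ω` in the class. -/
def foldClass (n : ℕ) (C : Set (List (Fin (2 * n + 1)))) : Set (List (Fin (2 * n))) :=
  ⋃ ω ∈ C, commClass (foldWord n ω)

/-- A Dynkin quiver of type `A_m`: an orientation of each of the `m - 1` edges. The edge `e` joins
the vertices `e` and `e + 1` (counted from `0`); `true` means the arrow `e → e + 1` and `false`
means the arrow `e + 1 → e`. -/
abbrev DynkinQuiverA (m : ℕ) : Type := Fin (m - 1) → Bool

namespace DynkinQuiverA

/-- There is an arrow `i → j` in `Q`. -/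
def Arrow {m : ℕ} (Q : DynkinQuiverA m) (i j : Fin m) : Prop :=
  ∃ e : Fin (m - 1),
    (Q e = true ∧ i.val = e.val ∧ j.val = e.val + 1) ∨
    (Q e = false ∧ i.val = e.val + 1 ∧ j.val = e.val)

/-- The vertex `i` is a sink of `Q`: no arrow leaves `i`. -/
def IsSink {m : ℕ} (Q : DynkinQuiverA m) (i : Fin m) : Prop :=
  ∀ j, ¬ Q.Arrow i j

/-- The quiver `i Q` obtained from `Q` by reversing every arrow incident with `i`. -/
def reverseAt {m : ℕ} (Q : DynkinQuiverA m) (i : Fin m) : DynkinQuiverA m :=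
  fun e => if e.val = i.val ∨ e.val + 1 = i.val then !(Q e) else Q e

/-- The word `i_1 ⋯ i_l` is adapted to `Q`: each `i_k` is a sink of `i_{k-1} ⋯ i_1 Q`. -/
def IsAdapted {m : ℕ} : DynkinQuiverA m → List (Fin m) → Prop
  | _, [] => True
  | Q, i :: ω => Q.IsSink i ∧ IsAdapted (Q.reverseAt i) ω

/-- The class `[Q]` of all reduced expressions of `w₀` adapted to `Q`. -/
def adaptedClass {m : ℕ} (Q : DynkinQuiverA m) : Set (List (Fin m)) :=
  {ω | IsReducedWordOfLongest ω ∧ Q.IsAdapted ω}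

/-- The number of arrows of `Q` between `i` and `j` that are directed toward `i`. -/
def arrowsToward {m : ℕ} (Q : DynkinQuiverA m) (i j : Fin m) : ℕ :=
  (Finset.univ.filter fun e : Fin (m - 1) =>
    (i.val ≤ e.val ∧ e.val < j.val ∧ Q e = false) ∨
    (j.val ≤ e.val ∧ e.val < i.val ∧ Q e = true)).card

/-- The quivers of type `A_{2n}` with `|a_i - b_i| = 1` for every vertex `i`, where `a_i` and `b_i`
count the arrows between `i` and `i^∨ = 2n + 1 - i` directed toward `i` and toward `i^∨`. -/
def balanced (n : ℕ) : Set (DynkinQuiverA (2 * n)) :=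
  {Q | ∀ i : Fin (2 * n), |(Q.arrowsToward i i.rev : ℤ) - (Q.arrowsToward i.rev i : ℤ)| = 1}

end DynkinQuiverA

/-! The Coxeter group of type `A_m` acts faithfully on `m + 1` points (`permHom_injective`) and
length counts inversions (`length_eq_card_invSet`), so a word is a reduced expression of `w₀`
exactly when it acts as the reversal and has `m(m+1)/2` letters. A commutation class is determined
by the restrictions of its words to pairs of noncommuting letters (`commEqv_of_pairFilter_eq`).

Part (1): moving the first letter `i` of a twisted Coxeter word to the end as `i^∨` does the same to
the product of its `2n + 1` twists, because `2n + 1` is odd. As `∨` is the involution `*`, this is a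
reflection functor. All twisted Coxeter words are connected by such rotations and commutations
(`IsPartialWord.moveEqv_centralWord`, by induction on the orbits from the centre outwards), so only
`1 2 ⋯ n+1` needs a computation, done in `baseWord_mul_revPerm_pow`.

Part (2): `P` commutes with `∨` and carries moves to moves, so the folded product is the twisted
product of a half word, one letter from each orbit in type `A_{2n}`, and it is reduced for the same
reason. The two neighbours of the centre commute before folding but not after it; nevertheless their
order never changes inside a class of `Ω`, because the three central letters of the product form a
sequence in which consecutive letters never commute (`IsTwistedCoxeterWord.triFilter_of_commEqv`).
The folded product of a half word `w` is adapted to the quiver whose arrows record which endpoint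
comes first in `w w^∨`. In this quiver the signed number of arrows between `i` and `i^∨` telescopes
to `1` or `-1` according to whether `i` lies in `w` (`drift_quiverOf`), hence it is balanced.
Conversely a balanced quiver tells which letters `w` has and in which order neighbours stand, so it
comes from a half word that is unique up to commutation. What folding forgets is only whether the
centre stands before or after its neighbour, which gives the two preimages. A balanced quiver
amounts to one sign in the middle and three possibilities for each of the `n - 1` further pairs of
mirror edges, whence the count. -/

namespace TypeA

/-! ### The Coxeter group of type A as a group of permutations -/

open Equiv

/-- The Coxeter system of type `A_m`. -/
abbrev cs (m : ℕ) : CoxeterSystem (CoxeterMatrix.A m) (CoxeterMatrix.A m).Group :=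
  (CoxeterMatrix.A m).toCoxeterSystem

theorem A_apply {m : ℕ} (i j : Fin m) : CoxeterMatrix.A m i j =
    if i = j then 1 else if j.val + 1 = i.val ∨ i.val + 1 = j.val then 3 else 2 := rfl

theorem A_eq_two_iff {m : ℕ} {i j : Fin m} : CoxeterMatrix.A m i j = 2 ↔
    i.val ≠ j.val ∧ j.val + 1 ≠ i.val ∧ i.val + 1 ≠ j.val := by
  rw [A_apply]
  simp only [Fin.ext_iff]
  split_ifs <;> simp <;> omega

/-- The adjacent transposition attached to a vertex of `A_m`. -/
def adjSwap {m : ℕ} (i : Fin m) : Perm (Fin (m + 1)) := swap i.castSucc i.succ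

theorem adjSwap_mul_self {m : ℕ} (i : Fin m) : adjSwap i * adjSwap i = 1 :=
  swap_mul_self _ _

theorem adjSwap_val {m : ℕ} (i : Fin m) (x : Fin (m + 1)) : (adjSwap i x).val =
    if x.val = i.val then i.val + 1 else if x.val = i.val + 1 then i.val else x.val := by
  rw [adjSwap, swap_apply_def]
  simp only [Fin.ext_iff, Fin.val_castSucc, Fin.val_succ]
  split_ifs <;> simp

theorem adjSwap_braid {m : ℕ} {i j : Fin m} (h : i.val + 1 = j.val) :
    adjSwap i * adjSwap j * adjSwap i = adjSwap j * adjSwap i * adjSwap j := by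
  have e : j.castSucc = i.succ := Fin.ext h.symm
  have h1 : i.castSucc ≠ i.succ := by simp [Fin.ext_iff]
  have h2 : i.castSucc ≠ j.succ := by
    simp only [ne_eq, Fin.ext_iff, Fin.val_castSucc, Fin.val_succ]; omega
  have h3 : i.succ ≠ j.succ := by simp only [ne_eq, Fin.ext_iff, Fin.val_succ]; omega
  rw [adjSwap, adjSwap, e, swap_mul_swap_mul_swap h1 h2, swap_comm i.castSucc i.succ,
    swap_comm i.succ j.succ, swap_mul_swap_mul_swap h3.symm h2.symm, swap_comm]

theorem adjSwap_isLiftable (m : ℕ) :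
    (CoxeterMatrix.A m).IsLiftable (adjSwap : Fin m → Perm (Fin (m + 1))) := by
  intro i j
  rw [A_apply]
  split_ifs with h h'
  · subst h; rw [pow_one, adjSwap_mul_self]
  · have hb : adjSwap i * adjSwap j * adjSwap i = adjSwap j * adjSwap i * adjSwap j := by
      rcases h' with h' | h'
      · exact (adjSwap_braid h').symm
      · exact adjSwap_braid h'
    calc (adjSwap i * adjSwap j) ^ 3
        = (adjSwap i * adjSwap j * adjSwap i) * (adjSwap j * adjSwap i * adjSwap j) := by
          simp only [pow_succ, pow_zero, one_mul, mul_assoc]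
      _ = adjSwap i * adjSwap j * (adjSwap i * adjSwap i) * adjSwap j * adjSwap i := by
          rw [← hb]; simp only [mul_assoc]
      _ = 1 := by
          rw [adjSwap_mul_self, mul_one, mul_assoc (adjSwap i), adjSwap_mul_self, mul_one,
            adjSwap_mul_self]
  · ext x
    rw [Fin.ext_iff] at h
    simp only [pow_succ, pow_zero, one_mul, Perm.mul_apply, Perm.one_apply, adjSwap_val]
    split_ifs <;> omega

/-- The action of the Coxeter group of type `A_m` on `m + 1` points. -/
def permHom (m : ℕ) : (CoxeterMatrix.A m).Group →* Perm (Fin (m + 1)) :=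
  (cs m).lift ⟨adjSwap, adjSwap_isLiftable m⟩

@[simp] theorem permHom_simple {m : ℕ} (i : Fin m) :
    permHom m ((cs m).simple i) = adjSwap i :=
  (cs m).lift_apply_simple (adjSwap_isLiftable m) i

theorem simple_comm {m : ℕ} {i j : Fin m} (h : CoxeterMatrix.A m i j = 2) :
    (cs m).simple i * (cs m).simple j = (cs m).simple j * (cs m).simple i := by
  have := (cs m).simple_mul_simple_pow i j
  rw [h, pow_two] at this
  rw [eq_comm, ← mul_inv_eq_one, mul_inv_rev, (cs m).inv_simple, (cs m).inv_simple]
  have := (cs m).simple_mul_simple_pow j i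
  rw [CoxeterMatrix.symmetric, h, pow_two] at this
  exact this

theorem simple_braid {m : ℕ} {i j : Fin m} (h : i.val + 1 = j.val) :
    (cs m).simple j * (cs m).simple i * (cs m).simple j =
      (cs m).simple i * (cs m).simple j * (cs m).simple i := by
  have hA : CoxeterMatrix.A m i j = 3 := by
    rw [A_apply, if_neg (by rw [Fin.ext_iff]; omega), if_pos (Or.inr h)]
  have := (cs m).simple_mul_simple_pow i j
  rw [hA, pow_succ, pow_two] at this
  rw [eq_comm, ← mul_inv_eq_one]
  simp only [mul_inv_rev, (cs m).inv_simple]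
  simpa only [mul_assoc] using this

/-- The inclusion of the Coxeter group of type `A_m` into that of type `A_{m+1}`. -/
def groupIncl (m : ℕ) : (CoxeterMatrix.A m).Group →* (CoxeterMatrix.A (m + 1)).Group :=
  (cs m).lift ⟨fun i => (cs (m + 1)).simple i.castSucc, fun i j => by
    have := (cs (m + 1)).simple_mul_simple_pow i.castSucc j.castSucc
    simpa [A_apply, Fin.ext_iff] using this⟩

@[simp] theorem groupIncl_simple {m : ℕ} (i : Fin m) :
    groupIncl m ((cs m).simple i) = (cs (m + 1)).simple i.castSucc :=
  (cs m).lift_apply_simple _ i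

/-- The minimal coset representative `s_m s_{m-1} ⋯ s_{m-j+1}` in type `A_{m+1}`. -/
def cosetRep (m : ℕ) : ℕ → (CoxeterMatrix.A (m + 1)).Group
  | 0 => 1
  | j + 1 => cosetRep m j * (cs (m + 1)).simple ⟨m - j, by omega⟩

theorem cosetRep_mul_of_lt {m j : ℕ} (i : Fin (m + 1)) (h : i.val + j < m) :
    cosetRep m j * (cs (m + 1)).simple i = (cs (m + 1)).simple i * cosetRep m j := by
  induction j with
  | zero => simp [cosetRep]
  | succ j ih =>
    rw [cosetRep, mul_assoc, simple_comm (A_eq_two_iff.2 (by simp only; omega)), ← mul_assoc,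
      ih (by omega), mul_assoc]

/-- The reflection commutes leftwards until it meets the factors `s_i s_{i-1}`; there the braid
relation turns it into `s_{i-1}`, which commutes with everything further left. -/
theorem cosetRep_mul_of_gt {m j : ℕ} (hj : j ≤ m) (i i' : Fin (m + 1)) (hi : i.val = i'.val + 1)
    (h : m < i.val + j) :
    cosetRep m (j + 1) * (cs (m + 1)).simple i = (cs (m + 1)).simple i' * cosetRep m (j + 1) := by
  induction j with
  | zero => omega
  | succ j ih =>
    by_cases hc : m < i.val + j
    · rw [cosetRep, mul_assoc, simple_comm (A_eq_two_iff.2 (by simp only; omega)), ← mul_assoc,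
        ih (by omega) hc, mul_assoc]
    · have e1 : (⟨m - j, by omega⟩ : Fin (m + 1)) = i := Fin.ext (by simp only; omega)
      have e2 : (⟨m - (j + 1), by omega⟩ : Fin (m + 1)) = i' := Fin.ext (by simp only; omega)
      rw [cosetRep, cosetRep, e1, e2, mul_assoc, mul_assoc, ← mul_assoc (CoxeterSystem.simple _ i),
        simple_braid hi.symm, ← mul_assoc, ← mul_assoc,
        cosetRep_mul_of_lt _ (by omega)]
      simp only [mul_assoc]

/-- Right multiplication by a simple reflection has four effects on the coset representative: it
commutes past it, lengthens it, shortens it, or passes through it with its index lowered by one. -/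
theorem exists_eq_groupIncl_mul_cosetRep {m : ℕ} (v : (CoxeterMatrix.A (m + 1)).Group) :
    ∃ h j, j ≤ m + 1 ∧ v = groupIncl m h * cosetRep m j := by
  induction v using (cs (m + 1)).simple_induction_right with
  | one => exact ⟨1, 0, by omega, by simp [cosetRep]⟩
  | mul_simple_right w i ih =>
    obtain ⟨h, j, hj, rfl⟩ := ih
    rcases lt_trichotomy (i.val + j) m with hlt | heq | hgt
    · refine ⟨h * (cs m).simple ⟨i, by omega⟩, j, hj, ?_⟩
      rw [mul_assoc, cosetRep_mul_of_lt i hlt, map_mul, groupIncl_simple, mul_assoc]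
      rfl
    · refine ⟨h, j + 1, by omega, ?_⟩
      rw [cosetRep, (Fin.ext (by simp only; omega) : (⟨m - j, by omega⟩ : Fin (m + 1)) = i),
        mul_assoc]
    · obtain ⟨k, rfl⟩ : ∃ k, j = k + 1 := ⟨j - 1, by omega⟩
      by_cases hk : i.val + k = m
      · refine ⟨h, k, by omega, ?_⟩
        rw [cosetRep, (Fin.ext (by simp only; omega) : (⟨m - k, by omega⟩ : Fin (m + 1)) = i),
          mul_assoc, CoxeterSystem.simple_mul_simple_cancel_right]
      · refine ⟨h * (cs m).simple ⟨i - 1, by omega⟩, k + 1, hj, ?_⟩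
        rw [mul_assoc, cosetRep_mul_of_gt (by omega) i ⟨i - 1, by omega⟩ (by simp only; omega)
          (by omega), map_mul, groupIncl_simple, mul_assoc]
        rfl

theorem permHom_cosetRep_apply {m j : ℕ} (hj : j ≤ m + 1) :
    permHom (m + 1) (cosetRep m j) ⟨m + 1 - j, by omega⟩ = Fin.last (m + 1) := by
  induction j with
  | zero => simp [cosetRep, Fin.last]
  | succ j ih =>
    rw [cosetRep, map_mul, Perm.mul_apply, permHom_simple, ← ih (by omega)]
    congr 1
    ext
    rw [adjSwap_val]
    simp only
    split_ifs <;> omega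

theorem permHom_groupIncl {m : ℕ} (h : (CoxeterMatrix.A m).Group) :
    permHom (m + 1) (groupIncl m h) (Fin.last (m + 1)) = Fin.last (m + 1) ∧
    ∀ x : Fin (m + 1), permHom (m + 1) (groupIncl m h) x.castSucc = (permHom m h x).castSucc := by
  induction h using (cs m).simple_induction_left with
  | one => simp
  | mul_simple_left w i ih =>
    simp only [map_mul, groupIncl_simple, permHom_simple, Perm.mul_apply, ih.1, ih.2,
      Fin.ext_iff, adjSwap_val, Fin.val_last, Fin.val_castSucc, implies_true, and_true]
    split_ifs <;> omega

/-- In the coset factorization, the point sent to the last one reveals the length `j` of the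
representative. For the identity permutation this forces `j = 0`, and induction applies to the
factor from the smaller group. -/
theorem permHom_injective (m : ℕ) : Function.Injective (permHom m) := by
  rw [injective_iff_map_eq_one]
  induction m with
  | zero =>
    intro v _
    induction v using (cs 0).simple_induction_left with
    | one => rfl
    | mul_simple_left w i => exact i.elim0
  | succ m ih =>
    intro v hv
    obtain ⟨h, j, hj, rfl⟩ := exists_eq_groupIncl_mul_cosetRep v
    have h1 := permHom_cosetRep_apply hj
    have h2 := congrArg (fun σ => σ (⟨m + 1 - j, by omega⟩ : Fin (m + 1 + 1))) hv
    simp only [map_mul, Perm.mul_apply, h1, (permHom_groupIncl h).1, Perm.one_apply, Fin.ext_iff,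
      Fin.val_last] at h2
    obtain rfl : j = 0 := by omega
    simp only [cosetRep, mul_one] at hv ⊢
    rw [ih h, map_one]
    ext x
    have := (permHom_groupIncl h).2 x
    rw [hv, Perm.one_apply, Fin.ext_iff] at this
    exact this.symm

/-! ### Inversions, length and the longest element -/

/-- The set of inversions of a permutation. -/
def invSet {k : ℕ} (σ : Perm (Fin k)) : Finset (Fin k × Fin k) :=
  Finset.univ.filter fun p => p.1 < p.2 ∧ σ p.2 < σ p.1

theorem mem_invSet {k : ℕ} {σ : Perm (Fin k)} {p : Fin k × Fin k} :
    p ∈ invSet σ ↔ p.1 < p.2 ∧ σ p.2 < σ p.1 := by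
  simp [invSet]

/-- An adjacent transposition of positions preserves the order of every pair except the pair it
exchanges, so it gives a bijection between the inversions other than that pair. -/
theorem card_invSet_mul_adjSwap {m : ℕ} (σ : Perm (Fin (m + 1))) (i : Fin m)
    (h : σ i.succ < σ i.castSucc) :
    (invSet (σ * adjSwap i)).card + 1 = (invSet σ).card := by
  have hlt : i.castSucc < i.succ := Fin.castSucc_lt_succ
  have hmem : (i.castSucc, i.succ) ∈ invSet σ := mem_invSet.2 ⟨hlt, h⟩
  rw [← Finset.card_erase_add_one hmem]
  congr 1
  have key : ∀ a b : Fin (m + 1), a < b → ¬ (a = i.castSucc ∧ b = i.succ) →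
      adjSwap i a < adjSwap i b := by
    intro a b
    simp only [Fin.lt_def, Fin.ext_iff, adjSwap_val, Fin.val_castSucc, Fin.val_succ]
    split_ifs <;> omega
  have inv : ∀ a, adjSwap i (adjSwap i a) = a := fun a => by
    rw [← Perm.mul_apply, adjSwap_mul_self, Perm.one_apply]
  have e1 : adjSwap i i.castSucc = i.succ := swap_apply_left _ _
  have e2 : adjSwap i i.succ = i.castSucc := swap_apply_right _ _
  refine Finset.card_bij' (fun p _ => (adjSwap i p.1, adjSwap i p.2))
    (fun p _ => (adjSwap i p.1, adjSwap i p.2)) ?_ ?_ ?_ ?_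
  · rintro ⟨a, b⟩ hp
    rw [mem_invSet, Perm.mul_apply, Perm.mul_apply] at hp
    rw [Finset.mem_erase, mem_invSet, ne_eq, Prod.mk.injEq]
    have hne : ¬ (a = i.castSucc ∧ b = i.succ) := by
      rintro ⟨rfl, rfl⟩
      simp only [e1, e2] at hp
      exact lt_asymm h hp.2
    refine ⟨?_, key a b hp.1 hne, hp.2⟩
    rintro ⟨h1, h2⟩
    have h1' := congrArg (adjSwap i) h1
    have h2' := congrArg (adjSwap i) h2
    simp only [inv, e1, e2] at h1' h2'
    rw [h1', h2'] at hp
    exact lt_asymm hlt hp.1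
  · rintro ⟨a, b⟩ hp
    rw [Finset.mem_erase, mem_invSet, ne_eq, Prod.mk.injEq] at hp
    rw [mem_invSet, Perm.mul_apply, Perm.mul_apply]
    simp only [inv]
    exact ⟨key a b hp.2.1 hp.1, hp.2.2⟩
  · rintro ⟨a, b⟩ _; simp [inv]
  · rintro ⟨a, b⟩ _; simp [inv]

theorem card_invSet_mul_adjSwap' {m : ℕ} (σ : Perm (Fin (m + 1))) (i : Fin m)
    (h : σ i.castSucc < σ i.succ) :
    (invSet (σ * adjSwap i)).card = (invSet σ).card + 1 := by
  have := card_invSet_mul_adjSwap (σ * adjSwap i) i (by simpa [adjSwap] using h)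
  rw [mul_assoc, adjSwap_mul_self, mul_one] at this
  exact this.symm

theorem succ_lt_or_lt_succ {m : ℕ} (σ : Perm (Fin (m + 1))) (i : Fin m) :
    σ i.succ < σ i.castSucc ∨ σ i.castSucc < σ i.succ := by
  rcases lt_trichotomy (σ i.succ) (σ i.castSucc) with h | h | h
  · exact Or.inl h
  · exact absurd (σ.injective h) (by simp [Fin.ext_iff])
  · exact Or.inr h

theorem eq_one_of_forall_lt {m : ℕ} (σ : Perm (Fin (m + 1)))
    (h : ∀ i : Fin m, σ i.castSucc < σ i.succ) : σ = 1 := by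
  have hm : StrictMono σ := Fin.strictMono_iff_lt_succ.2 h
  have : (hm.orderIsoOfSurjective σ σ.surjective) = OrderIso.refl _ := Subsingleton.elim _ _
  ext x
  have := congrArg (fun e : Fin (m + 1) ≃o Fin (m + 1) => e x) this
  simpa using congrArg Fin.val this

/-- Upper bound: removing descents one at a time reaches the identity permutation, which only the
trivial element induces. Lower bound: each letter changes the number of inversions by one. -/
theorem length_eq_card_invSet {m : ℕ} (v : (CoxeterMatrix.A m).Group) :
    (cs m).length v = (invSet (permHom m v)).card := by
  apply le_antisymm
  · generalize hk : (invSet (permHom m v)).card = k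
    induction k generalizing v with
    | zero =>
      have : permHom m v = 1 := by
        apply eq_one_of_forall_lt
        intro i
        refine (succ_lt_or_lt_succ _ i).resolve_left fun h => ?_
        have := card_invSet_mul_adjSwap _ i h
        omega
      rw [permHom_injective m (this.trans (map_one _).symm)]
      simp
    | succ k ih =>
      by_cases hd : ∀ i : Fin m, permHom m v i.castSucc < permHom m v i.succ
      · have := eq_one_of_forall_lt _ hd
        rw [permHom_injective m (this.trans (map_one _).symm)]
        simp
      · push Not at hd
        obtain ⟨i, hi⟩ := hd
        have hi' := (succ_lt_or_lt_succ _ i).resolve_right (not_lt.2 hi)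
        have h1 := card_invSet_mul_adjSwap _ i hi'
        have h2 := ih (v * (cs m).simple i) (by rw [map_mul, permHom_simple]; omega)
        have h3 := (cs m).length_mul_le (v * (cs m).simple i) ((cs m).simple i)
        rw [CoxeterSystem.simple_mul_simple_cancel_right, CoxeterSystem.length_simple] at h3
        omega
  · obtain ⟨ω, hω, rfl⟩ := (cs m).exists_isReduced v
    rw [hω.eq]
    clear hω
    induction ω using List.reverseRecOn with
    | nil =>
      simp only [CoxeterSystem.wordProd_nil, map_one, List.length_nil, nonpos_iff_eq_zero,
        Finset.card_eq_zero, invSet, Perm.one_apply]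
      refine Finset.filter_eq_empty_iff.2 fun p _ h => lt_asymm h.1 h.2
    | append_singleton ω i ih =>
      rw [CoxeterSystem.wordProd_append, CoxeterSystem.wordProd_singleton, map_mul, permHom_simple,
        List.length_append, List.length_singleton]
      rcases succ_lt_or_lt_succ (permHom m ((cs m).wordProd ω)) i with h | h
      · have := card_invSet_mul_adjSwap _ i h
        omega
      · have := card_invSet_mul_adjSwap' _ i h
        omega

theorem card_pairs (k : ℕ) :
    (Finset.univ.filter fun p : Fin k × Fin k => p.1 < p.2).card = k * (k - 1) / 2 := by
  rw [← Finset.sum_range_id_mul_two, Nat.mul_div_cancel _ two_pos, Finset.sum_range,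
    Finset.card_filter, Fintype.sum_prod_type_right]
  refine Finset.sum_congr rfl fun b _ => ?_
  rw [← Finset.card_filter]
  have : (Finset.univ.filter fun a : Fin k => a < b) = Finset.Iio b := by ext; simp
  rw [this, Fin.card_Iio]

theorem card_invSet_le {k : ℕ} (σ : Perm (Fin k)) : (invSet σ).card ≤ k * (k - 1) / 2 := by
  rw [← card_pairs]
  exact Finset.card_le_card fun p => by simp +contextual [invSet]

theorem card_invSet_revPerm (k : ℕ) :
    (invSet (Fin.revPerm : Perm (Fin k))).card = k * (k - 1) / 2 := by
  rw [← card_pairs, invSet]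
  congr 1
  ext p
  simp

theorem isReducedWordOfLongest_iff {m : ℕ} (ω : List (Fin m)) :
    IsReducedWordOfLongest ω ↔
      permHom m ((cs m).wordProd ω) = Fin.revPerm ∧ ω.length = (m + 1) * m / 2 := by
  constructor
  · rintro ⟨h1, h2⟩
    have hrev : permHom m ((cs m).wordProd ω) = Fin.revPerm := by
      -- An ascent of the permutation would allow a longer element, so it is decreasing; composed
      -- with the reversal it is increasing, hence the identity.
      have : Fin.revPerm * permHom m ((cs m).wordProd ω) = 1 := by
        apply eq_one_of_forall_lt
        intro i
        simp only [Perm.mul_apply, Fin.revPerm_apply, Fin.rev_lt_rev]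
        refine (succ_lt_or_lt_succ _ i).resolve_right fun h => ?_
        have h3 := card_invSet_mul_adjSwap' _ i h
        have h4 : (cs m).length ((cs m).wordProd ω * (cs m).simple i) ≤
            (cs m).length ((cs m).wordProd ω) := h2 _
        rw [length_eq_card_invSet, length_eq_card_invSet, map_mul, permHom_simple] at h4
        omega
      rw [mul_eq_one_iff_inv_eq] at this
      exact this.symm
    refine ⟨hrev, ?_⟩
    rw [← h1.eq, length_eq_card_invSet, hrev, card_invSet_revPerm]
    rfl
  · rintro ⟨h1, h2⟩
    have h3 : (cs m).length ((cs m).wordProd ω) = (m + 1) * m / 2 := by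
      rw [length_eq_card_invSet, h1, card_invSet_revPerm]
      rfl
    refine ⟨h3.trans h2.symm, fun v => ?_⟩
    rw [h3, length_eq_card_invSet]
    exact card_invSet_le _

end TypeA

/-! ### Commutation classes -/

namespace TypeA

open List

/-- Equivalence of words under commutation relations. -/
abbrev CommEqv {m : ℕ} (ω η : List (Fin m)) : Prop := Relation.EqvGen CommStep ω η

namespace CommEqv

variable {m : ℕ} {ω η θ : List (Fin m)}

theorem rfl' : CommEqv ω ω := .refl _

theorem symm' (h : CommEqv ω η) : CommEqv η ω := .symm _ _ h

theorem trans' (h : CommEqv ω η) (h' : CommEqv η θ) : CommEqv ω θ := .trans _ _ _ h h'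

theorem append_append (h : CommEqv ω η) (u v : List (Fin m)) :
    CommEqv (u ++ ω ++ v) (u ++ η ++ v) := by
  induction h with
  | rel _ _ h =>
    obtain ⟨u', v', i, j, h⟩ := h
    refine .rel _ _ ?_
    have := CommStep.swap (u ++ u') (v' ++ v) i j h
    simpa using this
  | refl _ => exact .refl _
  | symm _ _ _ ih => exact ih.symm'
  | trans _ _ _ _ _ ih ih' => exact ih.trans' ih'

theorem append_left (h : CommEqv ω η) (u : List (Fin m)) : CommEqv (u ++ ω) (u ++ η) := by
  simpa using h.append_append u []

theorem append_right (h : CommEqv ω η) (v : List (Fin m)) : CommEqv (ω ++ v) (η ++ v) := by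
  simpa using h.append_append [] v

theorem cons (h : CommEqv ω η) (a : Fin m) : CommEqv (a :: ω) (a :: η) :=
  h.append_left [a]

theorem perm (h : CommEqv ω η) : ω.Perm η := by
  induction h with
  | rel _ _ h =>
    obtain ⟨u, v, i, j, h⟩ := h
    exact (Perm.swap j i v).append_left u
  | refl _ => exact Perm.refl _
  | symm _ _ _ ih => exact ih.symm
  | trans _ _ _ _ _ ih ih' => exact ih.trans ih'

theorem wordProd_eq (h : CommEqv ω η) : (cs m).wordProd ω = (cs m).wordProd η := by
  induction h with
  | rel _ _ h =>
    obtain ⟨u, v, i, j, h⟩ := h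
    rw [CoxeterSystem.wordProd_append, CoxeterSystem.wordProd_append,
      CoxeterSystem.wordProd_cons, CoxeterSystem.wordProd_cons, CoxeterSystem.wordProd_cons,
      CoxeterSystem.wordProd_cons, ← mul_assoc (CoxeterSystem.simple _ i), simple_comm h, mul_assoc]
  | refl _ => rfl
  | symm _ _ _ ih => exact ih.symm
  | trans _ _ _ _ _ ih ih' => exact ih.trans ih'

theorem isReducedWordOfLongest (h : CommEqv ω η) (hω : IsReducedWordOfLongest ω) :
    IsReducedWordOfLongest η := by
  rw [isReducedWordOfLongest_iff] at hω ⊢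
  rwa [← h.wordProd_eq, ← h.perm.length_eq]

/-- A letter moves to the front past letters it commutes with. -/
theorem move_front {a : Fin m} {β : List (Fin m)} (h : ∀ b ∈ β, CoxeterMatrix.A m a b = 2)
    (γ : List (Fin m)) : CommEqv (β ++ a :: γ) (a :: (β ++ γ)) := by
  induction β with
  | nil => exact .refl _
  | cons b β ih =>
    refine ((ih fun c hc => h c (mem_cons_of_mem _ hc)).cons b).trans' (.rel _ _ ?_)
    have := h b mem_cons_self
    exact CommStep.swap [] (β ++ γ) b a (by rwa [CoxeterMatrix.symmetric])

/-- A commutation never exchanges two letters that are both kept by `p`. -/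
theorem filter_eq (h : CommEqv ω η) {p : Fin m → Bool}
    (hp : ∀ i j, p i → p j → CoxeterMatrix.A m i j ≠ 2) : ω.filter p = η.filter p := by
  induction h with
  | rel _ _ h =>
    obtain ⟨u, v, i, j, h⟩ := h
    have : ¬ (p i ∧ p j) := fun h' => hp i j h'.1 h'.2 h
    simp only [filter_append, filter_cons]
    split_ifs <;> simp_all
  | refl _ => rfl
  | symm _ _ _ ih => exact ih.symm
  | trans _ _ _ _ _ ih ih' => exact ih.trans ih'

end CommEqv

theorem commClass_eq_iff {m : ℕ} {ω η : List (Fin m)} :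
    commClass ω = commClass η ↔ CommEqv ω η := by
  constructor
  · intro h
    have : η ∈ commClass η := .refl _
    rw [← h] at this
    exact this
  · intro h
    ext θ
    exact ⟨fun h' => h.symm'.trans' h', fun h' => h.trans' h'⟩

/-- The restriction of a word to the letters `a` and `b`. -/
def pairFilter {m : ℕ} (a b : Fin m) (ω : List (Fin m)) : List (Fin m) :=
  ω.filter fun k => k = a ∨ k = b

section pairFilter

variable {m : ℕ} {a b : Fin m}

@[simp] theorem pairFilter_nil : pairFilter a b [] = [] := rfl

theorem pairFilter_append (ω η : List (Fin m)) :
    pairFilter a b (ω ++ η) = pairFilter a b ω ++ pairFilter a b η := filter_append ..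

theorem pairFilter_cons (x : Fin m) (ω : List (Fin m)) :
    pairFilter a b (x :: ω) =
      if x = a ∨ x = b then x :: pairFilter a b ω else pairFilter a b ω := by
  simp [pairFilter, filter_cons]

theorem mem_pairFilter {x : Fin m} {ω : List (Fin m)} :
    x ∈ pairFilter a b ω ↔ x ∈ ω ∧ (x = a ∨ x = b) := by
  simp [pairFilter]

theorem CommEqv.pairFilter_eq {ω η : List (Fin m)} (h : CommEqv ω η)
    (hab : CoxeterMatrix.A m a b ≠ 2) : pairFilter a b ω = pairFilter a b η := by
  refine h.filter_eq fun i j hi hj => ?_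
  simp only [decide_eq_true_eq] at hi hj
  rcases hi with rfl | rfl <;> rcases hj with rfl | rfl
  · simp
  · exact hab
  · rwa [CoxeterMatrix.symmetric]
  · simp

/-- Words with equal restrictions to all pairs of noncommuting letters are commutation
equivalent. -/
theorem commEqv_of_pairFilter_eq {ω η : List (Fin m)}
    (h : ∀ a b, CoxeterMatrix.A m a b ≠ 2 → pairFilter a b ω = pairFilter a b η) :
    CommEqv ω η := by
  induction ω generalizing η with
  | nil =>
    cases η with
    | nil => exact .refl _
    | cons a η =>
      have := h a a (by simp)
      simp [pairFilter_cons] at this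
  | cons a ω ih =>
    have haη : a ∈ η := by
      have : a ∈ pairFilter a a η := by
        rw [← h a a (by simp)]
        simp [pairFilter_cons]
      exact (mem_pairFilter.1 this).1
    obtain ⟨β, γ, rfl, haβ⟩ := eq_append_cons_of_mem haη
    -- The restriction of the other word to `{a, b}` begins with `a`, so no letter `b` that fails to
    -- commute with `a` can precede the first `a` here.
    have hβ : ∀ b ∈ β, CoxeterMatrix.A m a b = 2 := by
      intro b hb
      by_contra hab
      have h1 := h a b hab
      rw [pairFilter_append, pairFilter_cons, if_pos (Or.inl rfl)] at h1
      have h2 : b ∈ pairFilter a b β := mem_pairFilter.2 ⟨hb, Or.inr rfl⟩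
      obtain ⟨c, l, hl⟩ := exists_cons_of_ne_nil (ne_nil_of_mem h2)
      rw [hl, cons_append] at h1
      have h3 : c ∈ pairFilter a b β := by rw [hl]; exact mem_cons_self
      rw [← (cons.inj h1).1] at h3
      exact haβ (mem_pairFilter.1 h3).1
    have hmove := CommEqv.move_front hβ γ
    refine ((ih fun x y hxy => ?_).cons a).trans' hmove.symm'
    have h1 := (h x y hxy).trans (hmove.pairFilter_eq hxy)
    rw [pairFilter_cons, pairFilter_cons] at h1
    split_ifs at h1
    · exact (cons.inj h1).2
    · exact h1

end pairFilter

/-! ### Words adapted to a Dynkin quiver -/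

open DynkinQuiverA

section adapted

variable {m : ℕ}

/-- The smaller endpoint of an edge. -/
def lo (e : Fin (m - 1)) : Fin m := ⟨e, by omega⟩

/-- The larger endpoint of an edge. -/
def hi (e : Fin (m - 1)) : Fin m := ⟨e + 1, by omega⟩

/-- The source of the arrow on the edge `e`. -/
def src (Q : DynkinQuiverA m) (e : Fin (m - 1)) : Fin m := if Q e then lo e else hi e

theorem lo_ne_hi (e : Fin (m - 1)) : lo e ≠ hi e := by simp [lo, hi]

theorem A_lo_hi (e : Fin (m - 1)) : CoxeterMatrix.A m (lo e) (hi e) ≠ 2 := by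
  rw [ne_eq, A_eq_two_iff]; simp [lo, hi]

theorem isSink_iff {Q : DynkinQuiverA m} {i : Fin m} :
    Q.IsSink i ↔ ∀ e, i = lo e ∨ i = hi e → src Q e ≠ i := by
  simp only [IsSink, Arrow, Fin.ext_iff, src, lo, hi, not_exists, ne_eq]
  constructor
  · intro h e he hi
    cases hQ : Q e <;> simp only [hQ, if_true, if_false, Bool.false_eq_true] at hi
    · exact h ⟨e, by omega⟩ e (Or.inr ⟨hQ, hi.symm, rfl⟩)
    · exact h ⟨e + 1, by omega⟩ e (Or.inl ⟨hQ, hi.symm, rfl⟩)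
  · rintro h j e (⟨hQ, h1, h2⟩ | ⟨hQ, h1, h2⟩)
    · exact h e (Or.inl h1) (by simp [hQ, h1])
    · exact h e (Or.inr h1) (by simp [hQ, h1])

theorem src_reverseAt_of_eq {Q : DynkinQuiverA m} {i : Fin m} {e : Fin (m - 1)}
    (h : i = lo e ∨ i = hi e) (h' : src Q e ≠ i) : src (Q.reverseAt i) e = i := by
  have h1 : Q.reverseAt i e = !(Q e) := by
    simp only [lo, hi, Fin.ext_iff] at h
    exact if_pos (by omega)
  rw [src] at h' ⊢
  rw [h1]
  cases hQ : Q e <;> rw [hQ] at h' <;> simp at h' ⊢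
  · exact (h.resolve_right (Ne.symm h')).symm
  · exact (h.resolve_left (Ne.symm h')).symm

theorem src_reverseAt_of_ne {Q : DynkinQuiverA m} {i : Fin m} {e : Fin (m - 1)}
    (h : ¬ (i = lo e ∨ i = hi e)) : src (Q.reverseAt i) e = src Q e := by
  have h1 : Q.reverseAt i e = Q e := by
    simp only [lo, hi, Fin.ext_iff] at h
    exact if_neg (by omega)
  rw [src, src, h1]

/-- Adaptedness can be tested edge by edge: each occurrence of an endpoint must hit the current
target and then flips the arrow, so the two endpoints alternate, beginning with the target. -/
theorem isAdapted_iff {Q : DynkinQuiverA m} {ω : List (Fin m)} :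
    Q.IsAdapted ω ↔ ∀ e, IsChain (· ≠ ·) (src Q e :: pairFilter (lo e) (hi e) ω) := by
  induction ω generalizing Q with
  | nil => simp [IsAdapted]
  | cons i ω ih =>
    rw [IsAdapted, ih, isSink_iff, ← forall_and]
    refine forall_congr' fun e => ?_
    rw [pairFilter_cons]
    by_cases h : i = lo e ∨ i = hi e
    · rw [if_pos h, isChain_cons_cons]
      constructor
      · rintro ⟨h1, h2⟩
        rw [src_reverseAt_of_eq h (h1 h)] at h2
        exact ⟨h1 h, h2⟩
      · rintro ⟨h1, h2⟩
        rw [src_reverseAt_of_eq h h1]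
        exact ⟨fun _ => h1, h2⟩
    · rw [if_neg h, src_reverseAt_of_ne h]
      exact ⟨fun h => h.2, fun h' => ⟨fun h'' => absurd h'' h, h'⟩⟩

theorem CommEqv.isAdapted {ω η : List (Fin m)} (h : CommEqv ω η) {Q : DynkinQuiverA m}
    (hω : Q.IsAdapted ω) : Q.IsAdapted η := by
  rw [isAdapted_iff] at hω ⊢
  intro e
  rw [← h.pairFilter_eq (A_lo_hi e)]
  exact hω e

theorem exists_edge {i j : Fin m} (h : i ≠ j) (h' : CoxeterMatrix.A m i j ≠ 2) :
    ∃ e : Fin (m - 1), (i = lo e ∧ j = hi e) ∨ (j = lo e ∧ i = hi e) := by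
  rw [ne_eq, A_eq_two_iff] at h'
  simp only [lo, hi, Fin.ext_iff, ne_eq] at *
  by_cases h2 : i.val + 1 = j.val
  · exact ⟨⟨i, by omega⟩, Or.inl ⟨rfl, h2.symm⟩⟩
  · exact ⟨⟨j, by omega⟩, Or.inr ⟨rfl, by show i.val = j.val + 1; omega⟩⟩

/-- In an adapted word, the target of an arrow occurs before its source. -/
theorem mem_of_src {Q : DynkinQuiverA m} {δ ω : List (Fin m)} {e : Fin (m - 1)} {j : Fin m}
    (h : Q.IsAdapted (δ ++ src Q e :: ω)) (hδ : src Q e ∉ δ) (hj : j = lo e ∨ j = hi e)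
    (hj' : j ≠ src Q e) : j ∈ δ := by
  rw [isAdapted_iff] at h
  have hs : src Q e = lo e ∨ src Q e = hi e := by rw [src]; split_ifs <;> simp
  have h1 := h e
  rw [pairFilter_append, pairFilter_cons, if_pos hs] at h1
  cases hl : pairFilter (lo e) (hi e) δ with
  | nil => simp [hl] at h1
  | cons c l =>
    have hc : c ∈ pairFilter (lo e) (hi e) δ := by rw [hl]; exact mem_cons_self
    rw [mem_pairFilter] at hc
    have hc' : c ≠ src Q e := fun h => hδ (h ▸ hc.1)
    have : c = j := by
      rcases hc.2 with h1 | h1 <;> rcases hj with h2 | h2 <;> rcases hs with h3 | h3 <;>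
        simp_all
    exact this ▸ hc.1

/-- The first occurrence of a sink in an adapted word moves to the front. -/
theorem commute_of_isSink {Q : DynkinQuiverA m} {δ ω : List (Fin m)} {i : Fin m}
    (h : Q.IsAdapted (δ ++ i :: ω)) (hδ : i ∉ δ) (hi : Q.IsSink i) :
    ∀ x ∈ δ, CoxeterMatrix.A m i x = 2 := by
  intro x hx
  by_contra hA
  have hne : i ≠ x := fun h => hδ (h ▸ hx)
  obtain ⟨e, he⟩ := exists_edge hne hA
  have hsrc := isSink_iff.1 hi e (by tauto)
  have hsx : src Q e = x := by
    rw [src] at hsrc ⊢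
    split_ifs at hsrc ⊢ <;> rcases he with ⟨h1, h2⟩ | ⟨h1, h2⟩ <;> simp_all
  obtain ⟨δ₁, δ₂, rfl, hxδ⟩ := eq_append_cons_of_mem hx
  subst hsx
  rw [append_assoc, cons_append] at h
  have := mem_of_src h hxδ (j := i) (by tauto) hne
  exact hδ (mem_append_left _ this)

/-- The first letter of `ω` that also occurs in `η` is a sink, so it can be moved to the front of
both words. Splitting it off and reversing the quiver at it leaves shorter words, until the
remainders share no letter. -/
theorem exists_common_factor {Q : DynkinQuiverA m} {ω η : List (Fin m)}
    (hω : Q.IsAdapted ω) (hη : Q.IsAdapted η) :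
    ∃ γ α β, CommEqv ω (γ ++ α) ∧ CommEqv η (γ ++ β) ∧ ∀ x ∈ α, x ∉ β := by
  generalize hk : ω.length = k
  induction k using Nat.strong_induction_on generalizing Q ω η with
  | _ k ih =>
  by_cases hd : ∀ x ∈ ω, x ∉ η
  · exact ⟨[], ω, η, .refl _, .refl _, hd⟩
  push Not at hd
  obtain ⟨i, hi⟩ : ∃ i, ω.find? (fun x => decide (x ∈ η)) = some i := by
    rw [← Option.isSome_iff_exists, find?_isSome]
    simpa using hd
  obtain ⟨hiη, δ, ω', rfl, hδ⟩ := find?_eq_some_iff_append.1 hi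
  simp only [decide_eq_true_eq, Bool.not_eq_true', decide_eq_false_iff_not] at hiη hδ
  have hiδ : i ∉ δ := fun h => hδ i h hiη
  obtain ⟨δ', η', rfl, hiδ'⟩ := eq_append_cons_of_mem hiη
  -- The target of an arrow leaving `i` would precede `i` in both words, against the choice of `i`
  -- as the first common letter.
  have hsink : Q.IsSink i := by
    rw [isSink_iff]
    rintro e he rfl
    obtain ⟨j, hj, hj'⟩ : ∃ j, (j = lo e ∨ j = TypeA.hi e) ∧ j ≠ src Q e := by
      rcases he with h | h
      · exact ⟨TypeA.hi e, Or.inr rfl, by rw [h]; exact (lo_ne_hi e).symm⟩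
      · exact ⟨lo e, Or.inl rfl, by rw [h]; exact lo_ne_hi e⟩
    exact hδ j (mem_of_src hω hiδ hj hj') (mem_append_left _ (mem_of_src hη hiδ' hj hj'))
  have e1 := CommEqv.move_front (commute_of_isSink hω hiδ hsink) ω'
  have e2 := CommEqv.move_front (commute_of_isSink hη hiδ' hsink) η'
  obtain ⟨γ, α, β, h1, h2, h3⟩ := ih _ (by simp [← hk]) (e1.isAdapted hω).2 (e2.isAdapted hη).2 rfl
  exact ⟨i :: γ, α, β, e1.trans' (h1.cons i), e2.trans' (h2.cons i), h3⟩

end adapted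

/-! ### Adapted reduced words of the longest element form one commutation class -/

/-- A word avoiding the letter `i` stabilizes the set of points `≤ i`. -/
theorem permHom_apply_le_iff {m : ℕ} {ω : List (Fin m)} {i : Fin m} (h : i ∉ ω)
    (x : Fin (m + 1)) : (permHom m ((cs m).wordProd ω) x).val ≤ i.val ↔ x.val ≤ i.val := by
  induction ω with
  | nil => simp
  | cons j ω ih =>
    rw [mem_cons, not_or] at h
    rw [CoxeterSystem.wordProd_cons, map_mul, permHom_simple, Equiv.Perm.mul_apply, ← ih h.2,
      adjSwap_val]
    have := h.1
    rw [Fin.ext_iff] at this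
    split_ifs <;> omega

theorem mem_of_isReducedWordOfLongest {m : ℕ} {ω : List (Fin m)} (h : IsReducedWordOfLongest ω)
    (i : Fin m) : i ∈ ω := by
  by_contra hi
  have h1 := permHom_apply_le_iff hi 0
  rw [((isReducedWordOfLongest_iff ω).1 h).1] at h1
  simp [Fin.revPerm] at h1
  omega

/-- Each letter `i` is missing from one of the two words, so the common permutation stabilizes every
initial segment and is therefore the identity. -/
theorem wordProd_eq_one_of_disjoint {m : ℕ} {α β : List (Fin m)} (h : ∀ x ∈ α, x ∉ β)
    (hp : (cs m).wordProd α = (cs m).wordProd β) : (cs m).wordProd α = 1 := by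
  apply permHom_injective m
  rw [map_one]
  set σ := permHom m ((cs m).wordProd α) with hσ
  have key : ∀ (i : Fin m) (x : Fin (m + 1)), (σ x).val ≤ i.val ↔ x.val ≤ i.val := by
    intro i x
    by_cases hi : i ∈ α
    · rw [hσ, hp]
      exact permHom_apply_le_iff (h i hi) x
    · exact permHom_apply_le_iff hi x
  ext x
  rw [Equiv.Perm.one_apply]
  apply le_antisymm
  · by_cases hx : x.val < m
    · exact (key ⟨x, hx⟩ x).2 le_rfl
    · have := (σ x).isLt; omega
  · by_cases hx : (σ x).val < m
    · exact (key ⟨σ x, hx⟩ x).1 le_rfl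
    · have := x.isLt; omega

theorem eq_nil_of_isReduced_append {m : ℕ} {γ α : List (Fin m)}
    (h : (cs m).IsReduced (γ ++ α)) (hα : (cs m).wordProd α = 1) : α = [] := by
  have h1 := h.drop γ.length
  rw [drop_left, CoxeterSystem.IsReduced, hα, CoxeterSystem.length_one] at h1
  exact length_eq_zero_iff.1 h1.symm

/-- After the common factor is split off, the two remainders have equal products and disjoint
supports. Their product is thus trivial, and reducedness makes both empty. -/
theorem commEqv_of_mem_adaptedClass {m : ℕ} {Q : DynkinQuiverA m} {ω η : List (Fin m)}
    (hω : ω ∈ Q.adaptedClass) (hη : η ∈ Q.adaptedClass) : CommEqv ω η := by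
  obtain ⟨γ, α, β, h1, h2, h3⟩ := exists_common_factor hω.2 hη.2
  have r1 := h1.isReducedWordOfLongest hω.1
  have r2 := h2.isReducedWordOfLongest hη.1
  have hp : (cs m).wordProd α = (cs m).wordProd β := by
    have := permHom_injective m ((((isReducedWordOfLongest_iff _).1 r1).1).trans
      (((isReducedWordOfLongest_iff _).1 r2).1).symm)
    rwa [CoxeterSystem.wordProd_append, CoxeterSystem.wordProd_append, mul_right_inj] at this
  have hα := wordProd_eq_one_of_disjoint h3 hp
  have e1 := eq_nil_of_isReduced_append r1.1 hα
  have e2 := eq_nil_of_isReduced_append r2.1 (hp ▸ hα)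
  subst e1 e2
  exact h1.trans' h2.symm'

theorem commClass_eq_adaptedClass {m : ℕ} {Q : DynkinQuiverA m} {ω : List (Fin m)}
    (hω : ω ∈ Q.adaptedClass) : commClass ω = Q.adaptedClass := by
  ext η
  exact ⟨fun h => ⟨CommEqv.isReducedWordOfLongest h hω.1, CommEqv.isAdapted h hω.2⟩,
    fun h => commEqv_of_mem_adaptedClass hω h⟩

/-- Whichever endpoint of an edge occurs first must be the target of the arrow on that edge. -/
theorem eq_of_adapted {m : ℕ} {Q Q' : DynkinQuiverA m} {ω : List (Fin m)}
    (hω : ∀ i, i ∈ ω) (h : Q.IsAdapted ω) (h' : Q'.IsAdapted ω) : Q = Q' := by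
  funext e
  have h1 := isAdapted_iff.1 h e
  have h2 := isAdapted_iff.1 h' e
  cases hl : pairFilter (lo e) (hi e) ω with
  | nil =>
    have : lo e ∈ pairFilter (lo e) (hi e) ω := mem_pairFilter.2 ⟨hω _, Or.inl rfl⟩
    simp [hl] at this
  | cons c l =>
    have hc : c ∈ pairFilter (lo e) (hi e) ω := by rw [hl]; exact mem_cons_self
    rw [hl, isChain_cons_cons] at h1 h2
    have hc' := (mem_pairFilter.1 hc).2
    have h3 := h1.1
    have h4 := h2.1
    rw [src] at h3 h4
    have := lo_ne_hi e
    cases hq : Q e <;> cases hq' : Q' e <;> rw [hq] at h3 <;> rw [hq'] at h4 <;>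
      simp at h3 h4 ⊢ <;> grind

end TypeA

/-! ### Twisted products and elementary moves -/

namespace TypeA

open List Equiv

/-- The word `∏_{k < N} ω^{k∨}`. -/
def revProduct {m : ℕ} (N : ℕ) (ω : List (Fin m)) : List (Fin m) :=
  (List.range N).flatMap fun k => ω.map (Fin.rev^[k])

section revProduct

variable {m : ℕ}

theorem twistedProduct_eq (n : ℕ) (ω : List (Fin (2 * n + 1))) :
    twistedProduct n ω = revProduct (2 * n + 1) ω := rfl

theorem revProduct_succ (N : ℕ) (ω : List (Fin m)) :
    revProduct (N + 1) ω = revProduct N ω ++ ω.map (Fin.rev^[N]) := by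
  simp [revProduct, range_succ]

/-- Both sides are the same sequence, cut into blocks at positions shifted by one. -/
theorem revProduct_cons_append (N : ℕ) (i : Fin m) (u : List (Fin m)) :
    revProduct N (i :: u) ++ [Fin.rev^[N] i] = i :: revProduct N (u ++ [i.rev]) := by
  induction N with
  | zero => simp [revProduct]
  | succ N ih =>
    rw [revProduct_succ, revProduct_succ, map_cons, append_assoc, cons_append, map_append,
      map_singleton, ← Function.iterate_succ_apply, append_cons, ih]
    simp

theorem iterate_rev_of_odd {N : ℕ} (hN : Odd N) (i : Fin m) : Fin.rev^[N] i = i.rev := by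
  obtain ⟨k, rfl⟩ := hN
  change Fin.rev^[2 * k] i.rev = i.rev
  rw [Function.iterate_mul]
  have : (Fin.rev : Fin m → Fin m)^[2] = id := by funext x; simp
  rw [this, Function.iterate_id, id]

theorem iterate_rev_of_even {N : ℕ} (hN : Even N) (i : Fin m) : Fin.rev^[N] i = i := by
  obtain ⟨k, rfl⟩ := hN
  rw [← two_mul, Function.iterate_mul]
  have : (Fin.rev : Fin m → Fin m)^[2] = id := by funext x; simp
  rw [this, Function.iterate_id, id]

theorem length_revProduct (N : ℕ) (ω : List (Fin m)) :
    (revProduct N ω).length = N * ω.length := by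
  induction N with
  | zero => simp [revProduct]
  | succ N ih => rw [revProduct_succ, length_append, ih, length_map]; ring

theorem A_rev (i j : Fin m) : CoxeterMatrix.A m i.rev j.rev = CoxeterMatrix.A m i j := by
  simp only [A_apply, Fin.ext_iff, Fin.val_rev]
  have := i.isLt
  have := j.isLt
  congr 1
  · simp only [eq_iff_iff]; omega
  · congr 1; simp only [eq_iff_iff]; omega

theorem A_rev_iterate (k : ℕ) (i j : Fin m) :
    CoxeterMatrix.A m (Fin.rev^[k] i) (Fin.rev^[k] j) = CoxeterMatrix.A m i j := by
  induction k with
  | zero => rfl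
  | succ k ih => rw [Function.iterate_succ_apply', Function.iterate_succ_apply', A_rev, ih]

theorem CommEqv.map_iterate_rev {ω η : List (Fin m)} (h : CommEqv ω η) (k : ℕ) :
    CommEqv (ω.map (Fin.rev^[k])) (η.map (Fin.rev^[k])) := by
  induction h with
  | rel _ _ h =>
    obtain ⟨u, v, i, j, h⟩ := h
    simp only [map_append, map_cons]
    exact .rel _ _ (.swap _ _ _ _ (by rwa [A_rev_iterate]))
  | refl _ => exact .refl _
  | symm _ _ _ ih => exact ih.symm'
  | trans _ _ _ _ _ ih ih' => exact ih.trans' ih'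

theorem CommEqv.revProduct {ω η : List (Fin m)} (h : CommEqv ω η) (N : ℕ) :
    CommEqv (revProduct N ω) (revProduct N η) := by
  induction N with
  | zero => exact .refl _
  | succ N ih =>
    rw [revProduct_succ, revProduct_succ]
    exact (ih.append_right _).trans' ((h.map_iterate_rev N).append_left _)

end revProduct

/-- Elementary moves between words: commutation of letters in distinct orbits of the involution,
and moving the first letter to the end while applying the involution to it. -/
inductive Move {m : ℕ} : List (Fin m) → List (Fin m) → Prop
  | swap (u v : List (Fin m)) (i j : Fin m) (h : CoxeterMatrix.A m i j = 2) (h' : i ≠ j.rev) :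
      Move (u ++ i :: j :: v) (u ++ j :: i :: v)
  | rotate (i : Fin m) (u : List (Fin m)) : Move (i :: u) (u ++ [i.rev])

/-- The equivalence relation generated by elementary moves. -/
abbrev MoveEqv {m : ℕ} (ω η : List (Fin m)) : Prop := Relation.EqvGen Move ω η

section Move

variable {m : ℕ}

theorem adjSwap_rev (i : Fin m) :
    Fin.revPerm * adjSwap i.rev = adjSwap i * Fin.revPerm := by
  ext x
  simp only [Perm.mul_apply, Fin.revPerm_apply, Fin.val_rev, adjSwap_val]
  have := i.isLt
  have := x.isLt
  split_ifs <;> omega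

/-- This is the relation `s_i w₀ = w₀ s_{i*}`. -/
theorem isReducedWordOfLongest_rotate {i : Fin m} {X : List (Fin m)} :
    IsReducedWordOfLongest (i :: X) ↔ IsReducedWordOfLongest (X ++ [i.rev]) := by
  rw [isReducedWordOfLongest_iff, isReducedWordOfLongest_iff, CoxeterSystem.wordProd_cons,
    CoxeterSystem.wordProd_append, CoxeterSystem.wordProd_singleton, map_mul, map_mul,
    permHom_simple, permHom_simple, length_cons, length_append, length_singleton]
  refine and_congr_left fun _ => ?_
  constructor
  · intro h
    have : permHom m ((cs m).wordProd X) = adjSwap i * Fin.revPerm := by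
      rw [← h, ← mul_assoc, adjSwap_mul_self, one_mul]
    rw [this, ← adjSwap_rev, mul_assoc, adjSwap_mul_self, mul_one]
  · intro h
    have : permHom m ((cs m).wordProd X) = Fin.revPerm * adjSwap i.rev := by
      rw [← h, mul_assoc, adjSwap_mul_self, mul_one]
    rw [this, adjSwap_rev, ← mul_assoc, adjSwap_mul_self, one_mul]

/-- Oddness of `N` makes the letter that enters at the end equal to `i.rev`, which is what a
reflection functor appends when it removes `i`. -/
theorem exists_revProduct_rotate {N : ℕ} (hN : Odd N) (i : Fin m) (u : List (Fin m)) :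
    ∃ X, revProduct N (i :: u) = i :: X ∧ revProduct N (u ++ [i.rev]) = X ++ [i.rev] := by
  have h := revProduct_cons_append N i u
  rw [iterate_rev_of_odd hN] at h
  cases hX : revProduct N (i :: u) with
  | nil =>
    have := length_revProduct N (i :: u)
    obtain ⟨k, rfl⟩ := hN
    rw [hX, length_nil, length_cons] at this
    simp at this
  | cons j X =>
    rw [hX, cons_append] at h
    obtain ⟨rfl, h⟩ := cons.inj h
    exact ⟨X, rfl, h.symm⟩

/-- Symmetry makes the equivalence relation generated by moves compatible with the reflexive
transitive closure defining an r-cluster point. -/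
theorem ReflectionStep.symm {C D : Set (List (Fin m))} (h : ReflectionStep C D) :
    ReflectionStep D C := by
  cases h with
  | right i ω => simpa using ReflectionStep.left i.rev ω
  | left i ω => simpa using ReflectionStep.right i.rev ω

theorem MoveEqv.isReducedWordOfLongest_revProduct {ω η : List (Fin m)} (h : MoveEqv ω η) {N : ℕ}
    (hN : Odd N) :
    IsReducedWordOfLongest (revProduct N ω) ↔ IsReducedWordOfLongest (revProduct N η) := by
  induction h with
  | rel _ _ h =>
    cases h with
    | swap u v i j h _ =>
      have h1 : CommEqv (u ++ i :: j :: v) (u ++ j :: i :: v) := .rel _ _ (.swap u v i j h)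
      exact ⟨(h1.revProduct N).isReducedWordOfLongest, (h1.revProduct N).symm'.isReducedWordOfLongest⟩
    | rotate i u =>
      obtain ⟨X, h1, h2⟩ := exists_revProduct_rotate hN i u
      rw [h1, h2, isReducedWordOfLongest_rotate]
  | refl _ => rfl
  | symm _ _ _ ih => exact ih.symm
  | trans _ _ _ _ _ ih ih' => exact ih.trans ih'

theorem MoveEqv.reflTransGen_revProduct {ω η : List (Fin m)} (h : MoveEqv ω η) {N : ℕ}
    (hN : Odd N) :
    Relation.ReflTransGen ReflectionStep (commClass (revProduct N ω))
      (commClass (revProduct N η)) := by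
  induction h with
  | rel _ _ h =>
    cases h with
    | swap u v i j h _ =>
      have h1 : CommEqv (u ++ i :: j :: v) (u ++ j :: i :: v) := .rel _ _ (.swap u v i j h)
      rw [commClass_eq_iff.2 (h1.revProduct N)]
    | rotate i u =>
      obtain ⟨X, h1, h2⟩ := exists_revProduct_rotate hN i u
      rw [h1, h2]
      exact .single (.right i X)
  | refl _ => exact .refl
  | symm _ _ _ ih =>
    have : Std.Symm (ReflectionStep (m := m)) := ⟨fun _ _ => ReflectionStep.symm⟩
    exact Relation.ReflTransGen.stdSymm.symm _ _ ih
  | trans _ _ _ _ _ ih ih' => exact ih.trans ih'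

end Move

/-! ### The twisted product of the word `1 2 ⋯ k` -/

section base

variable {m : ℕ}

/-- The image of a word in the symmetric group. -/
def permWord (ω : List (Fin m)) : Perm (Fin (m + 1)) := permHom m ((cs m).wordProd ω)

theorem permWord_append (ω η : List (Fin m)) : permWord (ω ++ η) = permWord ω * permWord η := by
  rw [permWord, CoxeterSystem.wordProd_append, map_mul]; rfl

theorem permWord_singleton (i : Fin m) : permWord [i] = adjSwap i := by
  rw [permWord, CoxeterSystem.wordProd_singleton, permHom_simple]

theorem permWord_nil : permWord ([] : List (Fin m)) = 1 := by
  rw [permWord, CoxeterSystem.wordProd_nil, map_one]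

theorem permWord_map_rev (ω : List (Fin m)) :
    permWord (ω.map Fin.rev) = Fin.revPerm * permWord ω * Fin.revPerm⁻¹ := by
  induction ω with
  | nil => simp [permWord_nil]
  | cons i ω ih =>
    have h := adjSwap_rev i.rev
    rw [Fin.rev_rev] at h
    rw [map_cons, ← singleton_append, ← singleton_append (l := ω), permWord_append,
      permWord_append, ih, permWord_singleton, permWord_singleton, ← mul_assoc, ← mul_assoc,
      ← mul_assoc, h]

theorem permWord_map_iterate_rev (k : ℕ) (ω : List (Fin m)) :
    permWord (ω.map (Fin.rev^[k])) = Fin.revPerm ^ k * permWord ω * (Fin.revPerm ^ k)⁻¹ := by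
  induction k with
  | zero => simp
  | succ k ih =>
    rw [Function.iterate_succ', ← map_map, permWord_map_rev, ih, pow_succ', mul_inv_rev]
    simp only [mul_assoc]

/-- The `k`-th twist is conjugation by the `k`-th power of the reversal, and the product of these
conjugates telescopes. -/
theorem permWord_revProduct (N : ℕ) (ω : List (Fin m)) :
    permWord (revProduct N ω) = (permWord ω * Fin.revPerm) ^ N * (Fin.revPerm ^ N)⁻¹ := by
  induction N with
  | zero => simp [revProduct, permWord_nil]
  | succ N ih =>
    rw [revProduct_succ, permWord_append, ih, permWord_map_iterate_rev, pow_succ, pow_succ' _ N,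
      mul_inv_rev]
    group

/-- The word `1 2 ⋯ k`. -/
def baseWord (m k : ℕ) (h : k ≤ m) : List (Fin m) := List.ofFn fun j : Fin k => Fin.castLE h j

theorem permWord_baseWord (k : ℕ) (h : k ≤ m) (x : Fin (m + 1)) :
    (permWord (baseWord m k h) x).val =
      if x.val < k then x.val + 1 else if x.val = k then 0 else x.val := by
  induction k generalizing x with
  | zero =>
    simp only [baseWord, ofFn_zero, permWord_nil, Perm.one_apply]
    split_ifs <;> omega
  | succ k ih =>
    have : baseWord m (k + 1) h = baseWord m k (by omega) ++ [⟨k, h⟩] := by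
      rw [baseWord, ofFn_succ', concat_eq_append]
      rfl
    rw [this, permWord_append, Perm.mul_apply, ih, permWord_singleton, adjSwap_val]
    simp only
    split_ifs <;> omega

/-- The permutation runs through `0, m, 1, m - 1, …, n` and back to `0`, a cycle of length `2n + 1`.
This covers all points if `k = n`; if `k = n + 1`, the single remaining point `n + 1` is fixed. -/
theorem baseWord_mul_revPerm_pow {n k : ℕ} (h : k ≤ m) (hm : m = n + k) (hk : k = n ∨ k = n + 1) :
    (permWord (baseWord m k h) * Fin.revPerm) ^ (2 * n + 1) = 1 := by
  set f := permWord (baseWord m k h) * Fin.revPerm with hf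
  have hval : ∀ x : Fin (m + 1), (f x).val =
      if x.val < n then m - x.val else if x.val = n then 0 else m + 1 - x.val := by
    intro x
    rw [hf, Perm.mul_apply, permWord_baseWord, Fin.revPerm_apply, Fin.val_rev]
    have := x.isLt
    split_ifs <;> omega
  have heven : ∀ a, a ≤ n → ((f ^ (2 * a)) 0).val = a := by
    intro a
    induction a with
    | zero => simp
    | succ a ih =>
      intro ha
      have h1 := ih (by omega)
      rw [show 2 * (a + 1) = 2 * a + 1 + 1 by ring, pow_succ', Perm.mul_apply, hval, pow_succ',
        Perm.mul_apply, hval, h1]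
      split_ifs <;> omega
  have hodd : ∀ a, a < n → ((f ^ (2 * a + 1)) 0).val = m - a := by
    intro a ha
    rw [pow_succ', Perm.mul_apply, hval, heven a ha.le, if_pos ha]
  have hzero : (f ^ (2 * n + 1)) 0 = 0 := by
    ext
    rw [pow_succ', Perm.mul_apply, hval, heven n le_rfl]
    simp
  have hfix : ∀ j, (f ^ (2 * n + 1)) ((f ^ j) 0) = (f ^ j) 0 := by
    intro j
    rw [← Perm.mul_apply, ← pow_add, add_comm (2 * n + 1) j, pow_add, Perm.mul_apply, hzero]
  ext x
  rw [Perm.one_apply]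
  by_cases h1 : x.val ≤ n
  · have : x = (f ^ (2 * x.val)) 0 := Fin.ext (heven _ h1).symm
    rw [this, hfix]
  · by_cases h2 : m < x.val + n
    · have : x = (f ^ (2 * (m - x.val) + 1)) 0 := by
        ext
        rw [hodd _ (by omega)]
        omega
      rw [this, hfix]
    · have : f x = x := by
        ext
        rw [hval]
        split_ifs <;> omega
      rw [Perm.pow_apply_eq_self_of_apply_eq_self this]

theorem isReducedWordOfLongest_revProduct_baseWord {n k : ℕ} (h : k ≤ m) (hm : m = n + k)
    (hk : k = n ∨ k = n + 1) : IsReducedWordOfLongest (revProduct (2 * n + 1) (baseWord m k h)) := by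
  rw [isReducedWordOfLongest_iff, length_revProduct]
  constructor
  · have h1 := permWord_revProduct (2 * n + 1) (baseWord m k h)
    rw [baseWord_mul_revPerm_pow h hm hk, one_mul] at h1
    refine h1.trans ?_
    have : (Fin.revPerm : Perm (Fin (m + 1))) ^ 2 = 1 := by ext; simp [pow_two]
    rw [pow_succ, pow_mul, this, one_pow, one_mul]
    ext; simp
  · have : (baseWord m k h).length = k := by simp [baseWord]
    rw [this]
    rcases hk with rfl | rfl
    · rw [show (m + 1) * m = (2 * k + 1) * k * 2 by subst hm; ring,
        Nat.mul_div_cancel _ two_pos]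
    · rw [show (m + 1) * m = (2 * n + 1) * (n + 1) * 2 by subst hm; ring,
        Nat.mul_div_cancel _ two_pos]

end base

end TypeA

/-! ### Any two twisted Coxeter words are connected by moves -/

namespace TypeA

open List

/-- The number of letters of `w` in the orbit `{a, a^∨}`. -/
def orbCount {m : ℕ} (a : Fin m) (w : List (Fin m)) : ℕ :=
  w.countP fun k => decide (k = a ∨ k = a.rev)

/-- `w` has exactly one letter in each of the innermost `d + 1` orbits, and no other letter. -/
def IsPartialWord (n d : ℕ) (w : List (Fin (2 * n + 1))) : Prop :=
  ∀ a, orbCount a w = if n ≤ a.val + d ∧ a.val ≤ n + d then 1 else 0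

/-- The letter `x` lies in the orbit with index `d + 1`, counted from the centre. -/
def IsOuter (n d : ℕ) (x : Fin (2 * n + 1)) : Prop := x.val + d + 1 = n ∨ x.val = n + d + 1

section

variable {m n d : ℕ}

theorem orbCount_append (a : Fin m) (u v : List (Fin m)) :
    orbCount a (u ++ v) = orbCount a u + orbCount a v := countP_append ..

theorem orbCount_cons (a x : Fin m) (u : List (Fin m)) :
    orbCount a (x :: u) = orbCount a u + if x = a ∨ x = a.rev then 1 else 0 := by
  simp [orbCount, countP_cons]

theorem orbCount_nil (a : Fin m) : orbCount a [] = 0 := rfl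

theorem orbCount_pos {a x : Fin m} {u : List (Fin m)} (hx : x ∈ u) (h : x = a ∨ x = a.rev) :
    0 < orbCount a u := countP_pos_iff.2 ⟨x, hx, by simpa using h⟩

theorem Move.orbCount_eq {w w' : List (Fin m)} (h : Move w w') (a : Fin m) :
    orbCount a w = orbCount a w' := by
  cases h with
  | swap u v i j _ _ => simp only [orbCount_append, orbCount_cons]; ring
  | rotate i u =>
    rw [orbCount_append, orbCount_cons, orbCount_cons, orbCount_nil, zero_add]
    congr 2
    rw [Fin.rev_eq_iff, Fin.rev_inj, or_comm]

theorem MoveEqv.orbCount_eq {w w' : List (Fin m)} (h : MoveEqv w w') (a : Fin m) :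
    orbCount a w = orbCount a w' := by
  induction h with
  | rel _ _ h => exact h.orbCount_eq a
  | refl _ => rfl
  | symm _ _ _ ih => exact ih.symm
  | trans _ _ _ _ _ ih ih' => exact ih.trans ih'

theorem MoveEqv.isPartialWord {w w' : List (Fin (2 * n + 1))} (h : MoveEqv w w')
    (hw : IsPartialWord n d w) : IsPartialWord n d w' :=
  fun a => (h.orbCount_eq a).symm.trans (hw a)

theorem IsPartialWord.bounds {w : List (Fin (2 * n + 1))} (hw : IsPartialWord n d w)
    {a : Fin (2 * n + 1)} (ha : a ∈ w) : n ≤ a.val + d ∧ a.val ≤ n + d := by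
  have h1 := hw a
  have h2 := orbCount_pos ha (Or.inl rfl)
  by_contra h
  rw [if_neg h] at h1
  omega

theorem IsPartialWord.ne_of_append {u v : List (Fin (2 * n + 1))}
    (hw : IsPartialWord n d (u ++ v)) {a b : Fin (2 * n + 1)} (ha : a ∈ u) (hb : b ∈ v) :
    a ≠ b ∧ a ≠ b.rev := by
  have h1 := hw a
  have h2 := orbCount_pos ha (Or.inl rfl)
  rw [orbCount_append] at h1
  have h3 : ¬ (b = a ∨ b = a.rev) := by
    intro h
    have := orbCount_pos hb h
    split_ifs at h1 <;> omega
  refine ⟨fun h => h3 (Or.inl h.symm), fun h => h3 (Or.inr ?_)⟩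
  rw [h, Fin.rev_rev]

theorem MoveEqv.move_front {a : Fin m} {β : List (Fin m)}
    (h : ∀ b ∈ β, CoxeterMatrix.A m a b = 2 ∧ a ≠ b.rev) (γ : List (Fin m)) :
    MoveEqv (β ++ a :: γ) (a :: (β ++ γ)) := by
  suffices ∀ α, MoveEqv (α ++ β ++ a :: γ) (α ++ a :: (β ++ γ)) by simpa using this []
  induction β with
  | nil => intro α; simpa using Relation.EqvGen.refl _
  | cons b β ih =>
    intro α
    have h1 := ih (fun c hc => h c (mem_cons_of_mem _ hc)) (α ++ [b])
    have h2 := h b mem_cons_self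
    have h3 := Move.swap α (β ++ γ) b a (by rw [CoxeterMatrix.symmetric]; exact h2.1)
      fun h => h2.2 (by rw [h, Fin.rev_rev])
    refine .trans _ _ _ ?_ (.rel _ _ h3)
    simpa using h1

theorem MoveEqv.rotate (i : Fin m) (u : List (Fin m)) : MoveEqv (i :: u) (u ++ [i.rev]) :=
  .rel _ _ (.rotate i u)

theorem IsOuter.rev {x : Fin (2 * n + 1)} (hx : IsOuter n d x) : IsOuter n d x.rev := by
  rw [IsOuter, Fin.val_rev] at *
  omega

theorem IsOuter.commute {x b : Fin (2 * n + 1)} (hx : IsOuter n d x)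
    (h : n < b.val + d ∧ b.val < n + d) :
    CoxeterMatrix.A (2 * n + 1) x b = 2 ∧ x ≠ b.rev := by
  rw [IsOuter] at hx
  rw [A_eq_two_iff, ne_eq x, Fin.ext_iff, Fin.val_rev]
  omega

/-- The two ways in which an elementary move extends to words with one more outer letter. -/
def Lifts (n d : ℕ) (w w' : List (Fin (2 * n + 1))) : Prop :=
  (∀ x, IsOuter n d x → MoveEqv (x :: w) (x :: w')) ∨
    (∀ x, IsOuter n d x → MoveEqv (x :: w) (x.rev :: w'))

/-- For a rotation of `a`, first rotate `x` and then `a`, reaching `u x^∨ a^∨`. If `a` is in the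
orbit next to that of `x`, then `x^∨` commutes past all of `u`, which costs a flip of `x`. Otherwise
`x^∨` commutes with `a^∨` and can be rotated back to the front. -/
theorem Move.lifts {w w' : List (Fin (2 * n + 1))} (h : Move w w') (hw : IsPartialWord n d w) :
    Lifts n d w w' := by
  cases h with
  | swap u v i j h h' => exact Or.inl fun x _ => .rel _ _ (.swap (x :: u) v i j h h')
  | rotate a u =>
    have hrot : ∀ x : Fin (2 * n + 1), MoveEqv (x :: a :: u) (u ++ [x.rev, a.rev]) := fun x => by
      refine (MoveEqv.rotate x (a :: u)).trans _ _ _ ?_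
      simpa using MoveEqv.rotate a (u ++ [x.rev])
    have hb := hw.bounds (a := a) mem_cons_self
    have hu : ∀ b ∈ u, (n ≤ b.val + d ∧ b.val ≤ n + d) ∧ a ≠ b ∧ a ≠ b.rev := fun b hbu =>
      ⟨hw.bounds (mem_cons_of_mem _ hbu), hw.ne_of_append (u := [a]) mem_cons_self hbu⟩
    by_cases ha : a.val + d = n ∨ a.val = n + d
    · refine Or.inr fun x hx => (hrot x).trans _ _ _ ?_
      refine MoveEqv.move_front (fun b hbu => hx.rev.commute ?_) _
      obtain ⟨h1, h2, h3⟩ := hu b hbu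
      rw [ne_eq, Fin.ext_iff] at h2 h3
      rw [Fin.val_rev] at h3
      omega
    · refine Or.inl fun x hx => (hrot x).trans _ _ _ ?_
      have h1 := hx.rev.commute (b := a.rev) (by rw [Fin.val_rev]; omega)
      refine (Relation.EqvGen.rel _ _ (Move.swap u [] x.rev a.rev h1.1 h1.2)).trans _ _ _ ?_
      simpa using (MoveEqv.rotate x (u ++ [a.rev])).symm

theorem MoveEqv.lifts {w w' : List (Fin (2 * n + 1))} (h : MoveEqv w w')
    (hw : IsPartialWord n d w) : Lifts n d w w' := by
  induction h with
  | rel _ _ h => exact h.lifts hw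
  | refl _ => exact Or.inl fun x _ => .refl _
  | symm w w' h ih =>
    rcases ih (MoveEqv.isPartialWord (.symm _ _ h) hw) with h | h
    · exact Or.inl fun x hx => (h x hx).symm
    · refine Or.inr fun x hx => ?_
      have := h x.rev hx.rev
      rw [Fin.rev_rev] at this
      exact this.symm
  | trans _ _ _ h h' ih ih' =>
    have hw' := MoveEqv.isPartialWord h hw
    rcases ih hw with h1 | h1 <;> rcases ih' hw' with h2 | h2
    · exact Or.inl fun x hx => (h1 x hx).trans _ _ _ (h2 x hx)
    · exact Or.inr fun x hx => (h1 x hx).trans _ _ _ (h2 x hx)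
    · exact Or.inr fun x hx => (h1 x hx).trans _ _ _ (h2 _ hx.rev)
    · refine Or.inl fun x hx => (h1 x hx).trans _ _ _ ?_
      simpa using h2 _ hx.rev

/-- Only the letter from the adjacent inner orbit can obstruct the outer letter `x`. If it stands
before `x`, then `x` moves to the end and rotates to the front as `x^∨`; if not, `x` moves to the
front directly. -/
theorem IsPartialWord.exists_outer {w : List (Fin (2 * n + 1))} (hd : d + 1 ≤ n)
    (hw : IsPartialWord n (d + 1) w) :
    ∃ x w', IsOuter n d x ∧ IsPartialWord n d w' ∧ MoveEqv w (x :: w') := by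
  obtain ⟨x, hxw, hx⟩ : ∃ x ∈ w, IsOuter n d x := by
    have h1 := hw ⟨n - (d + 1), by omega⟩
    rw [if_pos (by simp only; omega)] at h1
    obtain ⟨x, hx, hx'⟩ := countP_pos_iff.1 (h1.symm ▸ Nat.one_pos : 0 < orbCount _ w)
    refine ⟨x, hx, ?_⟩
    rw [decide_eq_true_eq, Fin.ext_iff, Fin.ext_iff, Fin.val_rev] at hx'
    rw [IsOuter]
    simp only at hx'
    omega
  obtain ⟨α, β, rfl⟩ := append_of_mem hxw
  have hαβ : IsPartialWord n d (α ++ β) := by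
    intro a
    have h1 := hw a
    rw [orbCount_append, orbCount_cons, ← add_assoc, ← orbCount_append] at h1
    simp only [Fin.ext_iff, Fin.val_rev] at h1
    rw [IsOuter] at hx
    have := a.isLt
    split_ifs at h1 ⊢ <;> omega
  by_cases hα : ∃ a ∈ α, a.val + d = n ∨ a.val = n + d
  · obtain ⟨a, haα, ha⟩ := hα
    have hβ : ∀ b ∈ β, CoxeterMatrix.A (2 * n + 1) x.rev b.rev = 2 ∧ x.rev ≠ b.rev.rev := by
      intro b hb
      have h1 := hαβ.ne_of_append haα hb
      have h2 := hαβ.bounds (mem_append_right _ hb)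
      refine hx.rev.commute ?_
      rw [ne_eq, ne_eq, Fin.ext_iff, Fin.ext_iff, Fin.val_rev] at h1
      rw [Fin.val_rev]
      omega
    have hmove : ∀ γ δ : List (Fin (2 * n + 1)), (∀ b ∈ δ, b ∈ β) →
        MoveEqv (γ ++ x :: δ) (γ ++ δ ++ [x]) := by
      intro γ δ
      induction δ generalizing γ with
      | nil => intro _; simpa using Relation.EqvGen.refl _
      | cons b δ ih =>
        intro hδ
        have h1 := hβ b (hδ b mem_cons_self)
        rw [A_rev, Fin.rev_rev] at h1
        refine (Relation.EqvGen.rel _ _ (Move.swap γ δ x b h1.1 ?_)).trans _ _ _ ?_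
        · rintro rfl; exact h1.2 (Fin.rev_rev b)
        · simpa using ih (γ ++ [b]) fun c hc => hδ c (mem_cons_of_mem _ hc)
    refine ⟨x.rev, α ++ β, hx.rev, hαβ, (hmove α β fun _ h => h).trans _ _ _ ?_⟩
    simpa using (MoveEqv.rotate x.rev (α ++ β)).symm
  · push Not at hα
    refine ⟨x, α ++ β, hx, hαβ, MoveEqv.move_front (fun b hb => hx.commute ?_) β⟩
    have h1 := hα b hb
    have h2 := hαβ.bounds (mem_append_left _ hb)
    omega

/-- The word consisting of the letters from `n - d` to `n` in increasing order. -/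
def centralWord (n : ℕ) : ℕ → List (Fin (2 * n + 1))
  | 0 => [⟨n, by omega⟩]
  | d + 1 => ⟨n - (d + 1), by omega⟩ :: centralWord n d

theorem mem_centralWord {b : Fin (2 * n + 1)} (hb : b ∈ centralWord n d) :
    n ≤ b.val + d ∧ b.val ≤ n := by
  induction d with
  | zero =>
    rw [centralWord, mem_singleton] at hb
    subst hb; simp
  | succ d ih =>
    rw [centralWord, mem_cons] at hb
    rcases hb with rfl | hb
    · simp only; omega
    · have := ih hb; omega

theorem centralWord_eq_ofFn (hd : d ≤ n) : centralWord n d =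
    List.ofFn fun j : Fin (d + 1) => (⟨n - d + j, by omega⟩ : Fin (2 * n + 1)) := by
  induction d with
  | zero => simp [centralWord]
  | succ d ih =>
    rw [centralWord, ih (by omega)]
    symm
    rw [ofFn_succ]
    congr 1
    congr 1
    funext j
    ext
    simp only [Fin.val_succ]
    omega

/-- The outer letter can be flipped: rotate it to the end, then commute it to the front past letters
on the other side. Next to the centre this commutation fails; there rotating the centre, which `∨`
fixes, does the job. -/
theorem outer_cons_centralWord {y : Fin (2 * n + 1)} (hd : d + 1 ≤ n) (hy : IsOuter n d y) :
    MoveEqv (y :: centralWord n d) (centralWord n (d + 1)) := by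
  rw [centralWord]
  set z : Fin (2 * n + 1) := ⟨n - (d + 1), by omega⟩ with hz
  have hzo : IsOuter n d z := Or.inl (by simp only [hz]; omega)
  by_cases hyz : y = z
  · rw [hyz]; exact .refl _
  have hyr : y = z.rev := by
    rw [Fin.ext_iff, Fin.val_rev]
    rw [Fin.ext_iff] at hyz
    simp only [hz, IsOuter] at *
    omega
  rw [hyr]
  cases d with
  | zero =>
    simp only [centralWord]
    set c : Fin (2 * n + 1) := ⟨n, by omega⟩ with hc
    have hcr : c.rev = c := by ext; rw [Fin.val_rev]; simp only [hc]; omega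
    have h1 := MoveEqv.rotate z [c]
    have h2 := MoveEqv.rotate c [z]
    have h3 := MoveEqv.rotate c [z.rev]
    have h4 := MoveEqv.rotate z.rev [c]
    simp only [singleton_append, hcr, Fin.rev_rev] at h1 h2 h3 h4
    exact (h4.trans _ _ _ h2).trans _ _ _ (.refl _)
  | succ d =>
    refine .symm _ _ ((MoveEqv.rotate z _).trans _ _ _ ?_)
    have h1 := MoveEqv.move_front (a := z.rev) (β := centralWord n (d + 1)) (fun b hb => ?_) []
    · simpa using h1
    · have := mem_centralWord hb
      have h2 : z.rev.val = n + (d + 1) + 1 := by rw [Fin.val_rev]; simp only [hz]; omega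
      rw [A_eq_two_iff, ne_eq z.rev, Fin.ext_iff, Fin.val_rev b]
      omega

/-- An outer letter is brought to the front, the equivalence for the inner word is lifted past it at
the cost of a possible flip, and the flip is then corrected. -/
theorem IsPartialWord.moveEqv_centralWord {w : List (Fin (2 * n + 1))} (hd : d ≤ n)
    (hw : IsPartialWord n d w) : MoveEqv w (centralWord n d) := by
  induction d generalizing w with
  | zero =>
    have h1 : ∀ a ∈ w, a = ⟨n, by omega⟩ := fun a ha => by
      have := hw.bounds ha
      ext
      simp only
      omega
    have h2 := hw ⟨n, by omega⟩
    rw [if_pos (by simp), orbCount, countP_eq_length.2 fun a ha => by simp [h1 a ha]] at h2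
    obtain ⟨a, rfl⟩ := length_eq_one_iff.1 h2
    rw [centralWord, h1 a mem_cons_self]
    exact .refl _
  | succ d ih =>
    obtain ⟨x, w', hx, hw', h⟩ := hw.exists_outer hd
    refine h.trans _ _ _ ?_
    rcases (ih (by omega) hw').lifts hw' with h1 | h1
    · exact (h1 x hx).trans _ _ _ (outer_cons_centralWord hd hx)
    · exact (h1 x hx).trans _ _ _ (outer_cons_centralWord hd hx.rev)

theorem _root_.IsTwistedCoxeterWord.orbCount_eq {w : List (Fin (2 * n + 1))}
    (hw : IsTwistedCoxeterWord n w) (a : Fin (2 * n + 1)) : orbCount a w = 1 := hw a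

theorem _root_.IsTwistedCoxeterWord.moveEqv_baseWord {w : List (Fin (2 * n + 1))}
    (hw : IsTwistedCoxeterWord n w) :
    MoveEqv w (baseWord (2 * n + 1) (n + 1) (by omega)) := by
  have h1 : IsPartialWord n n w := fun a => by
    rw [if_pos (by omega)]; exact hw a
  have h2 := h1.moveEqv_centralWord le_rfl
  rw [centralWord_eq_ofFn le_rfl] at h2
  convert h2 using 1
  rw [baseWord]
  congr 1
  funext j
  ext
  simp

theorem _root_.IsTwistedCoxeterWord.isReducedWordOfLongest {w : List (Fin (2 * n + 1))}
    (hw : IsTwistedCoxeterWord n w) : IsReducedWordOfLongest (twistedProduct n w) :=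
  (MoveEqv.isReducedWordOfLongest_revProduct hw.moveEqv_baseWord ⟨n, rfl⟩).2
    (isReducedWordOfLongest_revProduct_baseWord _ (by ring) (Or.inr rfl))

theorem _root_.IsTwistedCoxeterWord.mem_cluster {w : List (Fin (2 * n + 1))}
    (hw : IsTwistedCoxeterWord n w) :
    commClass (twistedProduct n w) ∈ twistedAdaptedCluster n :=
  MoveEqv.reflTransGen_revProduct (.symm _ _ hw.moveEqv_baseWord) ⟨n, rfl⟩

end

end TypeA

/-! ### Folding onto type `A_{2n}` -/

namespace TypeA

open List

/-- The central vertex of type `A_{2n+1}`. -/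
def centre (n : ℕ) : Fin (2 * n + 1) := ⟨n, by omega⟩

section fold

variable {n : ℕ}

theorem rev_centre : (centre n).rev = centre n := by
  ext; rw [Fin.val_rev]; simp only [centre]; omega

theorem val_succAbove_centre (i : Fin (2 * n)) :
    ((centre n).succAbove i).val = if i.val < n then i.val else i.val + 1 := by
  rw [Fin.succAbove]
  simp only [centre, Fin.lt_def, Fin.val_castSucc]
  split_ifs <;> simp

theorem rev_succAbove_centre (i : Fin (2 * n)) :
    ((centre n).succAbove i).rev = (centre n).succAbove i.rev := by
  ext
  rw [Fin.val_rev, val_succAbove_centre, val_succAbove_centre, Fin.val_rev]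
  have := i.isLt
  split_ifs <;> omega

theorem foldWord_nil : foldWord n [] = [] := rfl

theorem foldWord_append (u v : List (Fin (2 * n + 1))) :
    foldWord n (u ++ v) = foldWord n u ++ foldWord n v := filterMap_append

theorem foldWord_centre_cons (u : List (Fin (2 * n + 1))) :
    foldWord n (centre n :: u) = foldWord n u := by
  simp [foldWord, centre]

theorem foldWord_succAbove_cons (i : Fin (2 * n)) (u : List (Fin (2 * n + 1))) :
    foldWord n ((centre n).succAbove i :: u) = i :: foldWord n u := by
  have h := val_succAbove_centre i
  rw [foldWord, filterMap_cons]
  split_ifs at h with h1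
  · simp [h, h1, foldWord]
  · have h2 : ¬ (i.val + 1 < n) := by omega
    have h3 : i.val + 1 ≠ n := by omega
    simp [h, h2, h3, foldWord]

theorem foldWord_induction {p : List (Fin (2 * n + 1)) → Prop} (nil : p [])
    (centre_cons : ∀ u, p u → p (centre n :: u))
    (succAbove_cons : ∀ i u, p u → p ((centre n).succAbove i :: u)) (u) : p u := by
  induction u with
  | nil => exact nil
  | cons x u ih =>
    rcases Fin.eq_self_or_eq_succAbove (centre n) x with rfl | ⟨i, rfl⟩
    · exact centre_cons u ih
    · exact succAbove_cons i u ih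

theorem foldWord_map_rev (u : List (Fin (2 * n + 1))) :
    foldWord n (u.map Fin.rev) = (foldWord n u).map Fin.rev := by
  induction u using foldWord_induction with
  | nil => rfl
  | centre_cons u ih => rw [map_cons, rev_centre, foldWord_centre_cons, foldWord_centre_cons, ih]
  | succAbove_cons i u ih =>
    rw [map_cons, rev_succAbove_centre, foldWord_succAbove_cons, foldWord_succAbove_cons, map_cons,
      ih]

theorem foldWord_map_iterate_rev (k : ℕ) (u : List (Fin (2 * n + 1))) :
    foldWord n (u.map (Fin.rev^[k])) = (foldWord n u).map (Fin.rev^[k]) := by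
  induction k with
  | zero => simp
  | succ k ih =>
    rw [Function.iterate_succ', ← map_map, foldWord_map_rev, ih, map_map, Function.iterate_succ']

theorem foldWord_revProduct (N : ℕ) (u : List (Fin (2 * n + 1))) :
    foldWord n (revProduct N u) = revProduct N (foldWord n u) := by
  induction N with
  | zero => rfl
  | succ N ih =>
    rw [revProduct_succ, revProduct_succ, foldWord_append, ih, foldWord_map_iterate_rev]

theorem count_foldWord (i : Fin (2 * n)) (u : List (Fin (2 * n + 1))) :
    (foldWord n u).count i = u.count ((centre n).succAbove i) := by
  induction u using foldWord_induction with
  | nil => rfl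
  | centre_cons u ih =>
    rw [foldWord_centre_cons, ih, count_cons_of_ne (Fin.succAbove_ne _ _).symm]
  | succAbove_cons j u ih =>
    rw [foldWord_succAbove_cons, count_cons, count_cons, ih]
    simp [Fin.succAbove_right_injective.eq_iff]

theorem pairFilter_foldWord (a b : Fin (2 * n)) (u : List (Fin (2 * n + 1))) :
    pairFilter a b (foldWord n u) =
      foldWord n (pairFilter ((centre n).succAbove a) ((centre n).succAbove b) u) := by
  induction u using foldWord_induction with
  | nil => rfl
  | centre_cons u ih =>
    rw [foldWord_centre_cons, ih, pairFilter_cons, if_neg]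
    have := Fin.succAbove_ne (centre n)
    rintro (h | h)
    · exact this a h.symm
    · exact this b h.symm
  | succAbove_cons j u ih =>
    rw [foldWord_succAbove_cons, pairFilter_cons, pairFilter_cons, ih]
    simp only [Fin.succAbove_right_injective.eq_iff]
    split_ifs
    · rw [foldWord_succAbove_cons]
    · rfl

theorem foldWord_map_succAbove (w : List (Fin (2 * n))) :
    foldWord n (w.map (centre n).succAbove) = w := by
  induction w with
  | nil => rfl
  | cons i w ih => rw [map_cons, foldWord_succAbove_cons, ih]

theorem map_succAbove_foldWord {u : List (Fin (2 * n + 1))} (h : centre n ∉ u) :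
    (foldWord n u).map (centre n).succAbove = u := by
  induction u using foldWord_induction with
  | nil => rfl
  | centre_cons u ih => exact absurd mem_cons_self h
  | succAbove_cons j u ih =>
    rw [foldWord_succAbove_cons, map_cons, ih fun h' => h (mem_cons_of_mem _ h')]

theorem Move.foldWord {u v : List (Fin (2 * n + 1))} (h : Move u v) :
    MoveEqv (foldWord n u) (foldWord n v) := by
  cases h with
  | swap u v i j h h' =>
    rw [foldWord_append, foldWord_append]
    rcases Fin.eq_self_or_eq_succAbove (centre n) i with rfl | ⟨i, rfl⟩
    · rcases Fin.eq_self_or_eq_succAbove (centre n) j with rfl | ⟨j, rfl⟩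
      · exact .refl _
      · simp only [foldWord_centre_cons, foldWord_succAbove_cons]; exact .refl _
    · rcases Fin.eq_self_or_eq_succAbove (centre n) j with rfl | ⟨j, rfl⟩
      · simp only [foldWord_centre_cons, foldWord_succAbove_cons]; exact .refl _
      · simp only [foldWord_succAbove_cons]
        rw [rev_succAbove_centre, ne_eq, Fin.succAbove_right_injective.eq_iff] at h'
        refine .rel _ _ (.swap _ _ i j ?_ h')
        -- The only commuting letters whose images do not commute are the two neighbours of the
        -- centre. They form one orbit, and a move never exchanges letters of the same orbit.
        rw [Fin.ext_iff, Fin.val_rev] at h'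
        rw [A_eq_two_iff, val_succAbove_centre, val_succAbove_centre] at h
        rw [A_eq_two_iff]
        split_ifs at h <;> omega
  | rotate i u =>
    rw [foldWord_append]
    rcases Fin.eq_self_or_eq_succAbove (centre n) i with rfl | ⟨i, rfl⟩
    · rw [rev_centre, foldWord_centre_cons, foldWord_centre_cons, foldWord_nil, append_nil]
      exact .refl _
    · rw [rev_succAbove_centre, foldWord_succAbove_cons, foldWord_succAbove_cons]
      exact .rel _ _ (.rotate _ _)

theorem MoveEqv.foldWord {u v : List (Fin (2 * n + 1))} (h : MoveEqv u v) :
    MoveEqv (foldWord n u) (foldWord n v) := by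
  induction h with
  | rel _ _ h => exact h.foldWord
  | refl _ => exact .refl _
  | symm _ _ _ ih => exact ih.symm
  | trans _ _ _ _ _ ih ih' => exact ih.trans _ _ _ ih'

theorem foldWord_baseWord :
    foldWord n (baseWord (2 * n + 1) (n + 1) (by omega)) = baseWord (2 * n) n (by omega) := by
  have h1 : baseWord (2 * n + 1) (n + 1) (by omega) =
      (baseWord (2 * n) n (by omega)).map (centre n).succAbove ++ [centre n] := by
    rw [baseWord, ofFn_succ', concat_eq_append, baseWord, map_ofFn]
    congr 2
    funext j
    ext
    rw [Function.comp_apply, val_succAbove_centre]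
    simp
  rw [h1, foldWord_append, foldWord_map_succAbove, foldWord_centre_cons, foldWord_nil, append_nil]

/-- The moves leading to `1 2 ⋯ n+1` fold to moves in type `A_{2n}` leading to `1 2 ⋯ n`, where the
case `k = n` of the base computation applies. -/
theorem _root_.IsTwistedCoxeterWord.isReducedWordOfLongest_foldWord
    {w : List (Fin (2 * n + 1))} (hw : IsTwistedCoxeterWord n w) :
    IsReducedWordOfLongest (foldWord n (twistedProduct n w)) := by
  rw [twistedProduct_eq, foldWord_revProduct]
  have h := hw.moveEqv_baseWord.foldWord
  rw [foldWord_baseWord] at h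
  exact (h.isReducedWordOfLongest_revProduct ⟨n, rfl⟩).2
    (isReducedWordOfLongest_revProduct_baseWord _ (by ring) (Or.inl rfl))

end fold

/-! ### Rigidity of the three central letters -/

section rigid

variable {m : ℕ}

/-- If no two consecutive letters of the restriction commute, no commutation can exchange two of its
letters. The hypothesis is allowed on either word so that the induction passes through symmetry. -/
theorem isChain_filter_of_commEqv {ω η : List (Fin m)} (h : CommEqv ω η) (p : Fin m → Bool) :
    (IsChain (fun i j => CoxeterMatrix.A m i j ≠ 2) (ω.filter p) → ω.filter p = η.filter p) ∧
    (IsChain (fun i j => CoxeterMatrix.A m i j ≠ 2) (η.filter p) → ω.filter p = η.filter p) := by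
  induction h with
  | rel _ _ h =>
    obtain ⟨u, v, i, j, h⟩ := h
    have h' : CoxeterMatrix.A m j i = 2 := by rwa [CoxeterMatrix.symmetric]
    simp only [filter_append, filter_cons]
    split_ifs
    · constructor
      · intro hc
        exact absurd h (isChain_cons_cons.1 (IsChain.right_of_append hc)).1
      · intro hc
        exact absurd h' (isChain_cons_cons.1 (IsChain.right_of_append hc)).1
    all_goals simp
  | refl _ => simp
  | symm _ _ _ ih => exact ⟨fun h => (ih.2 h).symm, fun h => (ih.1 h).symm⟩
  | trans _ _ _ _ _ ih ih' =>
    constructor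
    · intro h
      have h1 := ih.1 h
      exact h1.trans (ih'.1 (h1 ▸ h))
    · intro h
      have h1 := ih'.2 h
      exact (ih.2 (h1.symm ▸ h)).trans h1

theorem revProduct_succ_left (N : ℕ) (ω : List (Fin m)) :
    revProduct (N + 1) ω = ω ++ revProduct N (ω.map Fin.rev) := by
  induction N with
  | zero => simp [revProduct]
  | succ N ih =>
    rw [revProduct_succ, ih, revProduct_succ, map_map, append_assoc, Function.iterate_succ]

theorem isChain_revProduct_pair (N : ℕ) {x y : Fin m} (hxy : CoxeterMatrix.A m x y ≠ 2)
    (hyx : CoxeterMatrix.A m y x.rev ≠ 2) :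
    IsChain (fun i j => CoxeterMatrix.A m i j ≠ 2) (revProduct N [x, y]) := by
  induction N generalizing x y with
  | zero => simp [revProduct]
  | succ N ih =>
    have h := ih (x := x.rev) (y := y.rev) (by rwa [A_rev]) (by rwa [A_rev])
    rw [revProduct_succ_left]
    cases N with
    | zero => simpa [revProduct] using hxy
    | succ N =>
      rw [map_cons, map_singleton]
      rw [revProduct_succ_left] at h ⊢
      exact isChain_cons_cons.2 ⟨hxy, isChain_cons_cons.2 ⟨hyx, h⟩⟩

/-- The restriction of a word of type `A_{2n+1}` to the three central letters. -/
def triFilter (n : ℕ) (ω : List (Fin (2 * n + 1))) : List (Fin (2 * n + 1)) :=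
  ω.filter fun k => n ≤ k.val + 1 ∧ k.val ≤ n + 1

theorem triFilter_map_rev (n k : ℕ) (ω : List (Fin (2 * n + 1))) :
    triFilter n (ω.map (Fin.rev^[k])) = (triFilter n ω).map (Fin.rev^[k]) := by
  rw [triFilter, filter_map, triFilter]
  congr 1
  refine filter_congr fun x _ => ?_
  rw [Function.comp_apply, decide_eq_decide]
  rcases Nat.even_or_odd k with hk | hk
  · rw [iterate_rev_of_even hk]
  · rw [iterate_rev_of_odd hk, Fin.val_rev]
    omega

theorem triFilter_revProduct (n N : ℕ) (ω : List (Fin (2 * n + 1))) :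
    triFilter n (revProduct N ω) = revProduct N (triFilter n ω) := by
  induction N with
  | zero => rfl
  | succ N ih =>
    rw [revProduct_succ, revProduct_succ, ← triFilter_map_rev, ← ih]
    exact filter_append ..

theorem pairFilter_triFilter {n : ℕ} {a b : Fin (2 * n + 1)} (ha : n ≤ a.val + 1 ∧ a.val ≤ n + 1)
    (hb : n ≤ b.val + 1 ∧ b.val ≤ n + 1) (ω : List (Fin (2 * n + 1))) :
    pairFilter a b (triFilter n ω) = pairFilter a b ω := by
  rw [pairFilter, triFilter, filter_filter, pairFilter]
  refine filter_congr fun x _ => ?_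
  by_cases h : x = a ∨ x = b
  · rcases h with rfl | rfl <;> simp [ha, hb]
  · simp [h]

theorem mem_triFilter {n : ℕ} {x : Fin (2 * n + 1)} {ω : List (Fin (2 * n + 1))} :
    x ∈ triFilter n ω ↔ x ∈ ω ∧ (n ≤ x.val + 1 ∧ x.val ≤ n + 1) := by
  simp [triFilter]

/-- The three central letters occur in a twisted Coxeter word as the centre and one neighbour of
it, in some order. -/
theorem _root_.IsTwistedCoxeterWord.triFilter_eq {n : ℕ} (hn : 1 ≤ n)
    {w : List (Fin (2 * n + 1))} (hw : IsTwistedCoxeterWord n w) :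
    ∃ x : Fin (2 * n + 1), (x.val + 1 = n ∨ x.val = n + 1) ∧ x ∈ w ∧
      (triFilter n w = [centre n, x] ∨ triFilter n w = [x, centre n]) := by
  -- The three central letters make up two orbits, the centre and its pair of neighbours, so the
  -- restriction of `w` to them has length two.
  have key : ∀ (l : List (Fin (2 * n + 1))), (∀ x ∈ l, n ≤ x.val + 1 ∧ x.val ≤ n + 1) →
      l.length = orbCount (centre n) l + orbCount (⟨n - 1, by omega⟩ : Fin (2 * n + 1)) l := by
    intro l
    induction l with
    | nil => intro _; rfl
    | cons x l ih =>
      intro h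
      rw [length_cons, ih fun y hy => h y (mem_cons_of_mem _ hy), orbCount_cons, orbCount_cons,
        rev_centre]
      have h1 := h x mem_cons_self
      simp only [Fin.ext_iff, Fin.val_rev, centre]
      split_ifs <;> omega
  have hcount : ∀ a : Fin (2 * n + 1), (n ≤ a.val + 1 ∧ a.val ≤ n + 1) →
      orbCount a (triFilter n w) = 1 := by
    intro a ha
    refine Eq.trans ?_ (hw.orbCount_eq a)
    rw [orbCount, triFilter, countP_filter, orbCount]
    refine countP_congr fun x _ => ?_
    simp only [Fin.ext_iff, Fin.val_rev, decide_eq_true_eq, Bool.and_eq_true]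
    omega
  have hmem : ∀ x ∈ triFilter n w, n ≤ x.val + 1 ∧ x.val ≤ n + 1 := fun x hx =>
    (mem_triFilter.1 hx).2
  have c1 := hcount (centre n) (by simp only [centre]; omega)
  have c2 := hcount ⟨n - 1, by omega⟩ (by simp only; omega)
  have hlen := key _ hmem
  rw [c1, c2] at hlen
  obtain ⟨a, b, hab⟩ := length_eq_two.1 hlen
  have ha := hmem a (by simp [hab])
  have hb := hmem b (by simp [hab])
  have ha' : a ∈ w := (mem_triFilter.1 (hab ▸ mem_cons_self : a ∈ triFilter n w)).1
  have hb' : b ∈ w := (mem_triFilter.1 (by rw [hab]; simp : b ∈ triFilter n w)).1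
  rw [hab, orbCount_cons, orbCount_cons, orbCount_nil, rev_centre] at c1
  by_cases hac : a = centre n
  · have hbc : b ≠ centre n := by rintro rfl; simp [hac] at c1
    refine ⟨b, ?_, hb', Or.inl (by rw [hab, hac])⟩
    rw [ne_eq, Fin.ext_iff] at hbc
    simp only [centre] at hbc
    omega
  · have hbc : b = centre n := by by_contra hbc; simp [hac, hbc] at c1
    refine ⟨a, ?_, ha', Or.inr (by rw [hab, hbc])⟩
    rw [Fin.ext_iff] at hac
    simp only [centre] at hac
    omega

/-- In the product the centre, fixed by `∨`, alternates with its two neighbours in turn, so no two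
consecutive central letters commute. -/
theorem _root_.IsTwistedCoxeterWord.triFilter_of_commEqv {n : ℕ} (hn : 1 ≤ n)
    {w : List (Fin (2 * n + 1))} (hw : IsTwistedCoxeterWord n w) {ω : List (Fin (2 * n + 1))}
    (h : CommEqv (twistedProduct n w) ω) :
    triFilter n (twistedProduct n w) = triFilter n ω := by
  refine (isChain_filter_of_commEqv h _).1 ?_
  change IsChain _ (triFilter n (revProduct _ w))
  rw [triFilter_revProduct]
  obtain ⟨x, hx, -, h1 | h1⟩ := hw.triFilter_eq hn <;> rw [h1] <;>
    refine isChain_revProduct_pair _ ?_ ?_ <;> rw [ne_eq, A_eq_two_iff] <;>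
    simp only [Fin.val_rev, centre] <;> omega

/-- The restriction of a word is recovered as the first two letters of the restriction of its
product. -/
theorem _root_.IsTwistedCoxeterWord.triFilter_eq_of_commEqv {n : ℕ} (hn : 1 ≤ n)
    {w w' : List (Fin (2 * n + 1))} (hw : IsTwistedCoxeterWord n w)
    (hw' : IsTwistedCoxeterWord n w') (h : CommEqv (twistedProduct n w) (twistedProduct n w')) :
    triFilter n w = triFilter n w' := by
  have h1 := hw.triFilter_of_commEqv hn h
  rw [twistedProduct_eq, twistedProduct_eq, triFilter_revProduct, triFilter_revProduct,
    revProduct_succ_left, revProduct_succ_left] at h1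
  refine append_inj_left h1 ?_
  obtain ⟨x, -, -, h2 | h2⟩ := hw.triFilter_eq hn <;>
    obtain ⟨y, -, -, h3 | h3⟩ := hw'.triFilter_eq hn <;> rw [h2, h3] <;> rfl

/-- A noncommuting pair in type `A_{2n}` comes either from a noncommuting pair, whose restriction is
invariant anyway, or from the two neighbours of the centre, whose restriction is rigid. -/
theorem _root_.IsTwistedCoxeterWord.commEqv_foldWord {n : ℕ} (hn : 1 ≤ n)
    {w : List (Fin (2 * n + 1))} (hw : IsTwistedCoxeterWord n w) {ω : List (Fin (2 * n + 1))}
    (h : CommEqv (twistedProduct n w) ω) :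
    CommEqv (foldWord n (twistedProduct n w)) (foldWord n ω) := by
  refine commEqv_of_pairFilter_eq fun a b hab => ?_
  rw [pairFilter_foldWord, pairFilter_foldWord]
  congr 1
  by_cases hA : CoxeterMatrix.A (2 * n + 1) ((centre n).succAbove a) ((centre n).succAbove b) = 2
  · have ht := hw.triFilter_of_commEqv hn h
    rw [A_eq_two_iff, val_succAbove_centre, val_succAbove_centre] at hA
    rw [ne_eq, A_eq_two_iff] at hab
    rw [← pairFilter_triFilter, ht, pairFilter_triFilter] <;> rw [val_succAbove_centre] <;>
      split_ifs at hA ⊢ <;> omega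
  · exact h.pairFilter_eq hA

end rigid

end TypeA

/-! ### Half words and their quivers -/

namespace TypeA

open List DynkinQuiverA

/-- `w` has exactly one letter in each orbit of the fixed-point-free involution `rev`. -/
def IsHalfWord {m : ℕ} (w : List (Fin m)) : Prop := ∀ i, w.count i + w.count i.rev = 1

section half

variable {m : ℕ} {w : List (Fin m)}

theorem IsHalfWord.rev_mem_iff (hw : IsHalfWord w) (i : Fin m) : i.rev ∈ w ↔ i ∉ w := by
  have := hw i
  rw [← count_pos_iff, ← count_pos_iff]
  omega

theorem IsHalfWord.count_eq_one (hw : IsHalfWord w) {i : Fin m} (hi : i ∈ w) : w.count i = 1 := by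
  have := hw i
  rw [← count_pos_iff] at hi
  omega

/-- The word `w w^∨`. -/
def double (w : List (Fin m)) : List (Fin m) := w ++ w.map Fin.rev

theorem count_map_rev (i : Fin m) : (w.map Fin.rev).count i = w.count i.rev := by
  rw [← count_map_of_injective w Fin.rev Fin.rev_injective, Fin.rev_rev]

theorem IsHalfWord.count_double (hw : IsHalfWord w) (i : Fin m) : (double w).count i = 1 := by
  rw [double, count_append, count_map_rev]
  exact hw i

theorem idxOf_map_rev (i : Fin m) : (w.map Fin.rev).idxOf i = w.idxOf i.rev := by
  induction w with
  | nil => rfl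
  | cons x w ih =>
    rw [map_cons, idxOf_cons, idxOf_cons, ih]
    have : (x.rev == i) = (x == i.rev) := by
      rw [Bool.eq_iff_iff, beq_iff_eq, beq_iff_eq, Fin.rev_eq_iff]
    rw [this]

theorem idxOf_double (i : Fin m) : (double w).idxOf i =
    if i ∈ w then w.idxOf i else w.idxOf i.rev + w.length := by
  rw [double, idxOf_append, idxOf_map_rev]

theorem pairFilter_of_notMem {a b : Fin m} {D : List (Fin m)} (ha : a ∉ D) :
    pairFilter a b D = replicate (D.count b) b := by
  rw [← filter_beq, pairFilter]
  refine filter_congr fun x hx => ?_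
  have : x ≠ a := fun h => ha (h ▸ hx)
  rw [Bool.eq_iff_iff]
  simp [this]

theorem pairFilter_comm (a b : Fin m) (D : List (Fin m)) :
    pairFilter a b D = pairFilter b a D := by
  rw [pairFilter, pairFilter]
  exact filter_congr fun x _ => decide_eq_decide.2 or_comm

theorem pairFilter_of_count_eq_one {a b : Fin m} {D : List (Fin m)} (hab : a ≠ b)
    (ha : D.count a = 1) (hb : D.count b = 1) :
    pairFilter a b D = if D.idxOf b < D.idxOf a then [b, a] else [a, b] := by
  induction D with
  | nil => simp at ha
  | cons x D ih =>
    by_cases hxa : x = a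
    · subst hxa
      rw [count_cons_self] at ha
      rw [count_cons_of_ne hab] at hb
      have ha' : x ∉ D := count_eq_zero.1 (by omega)
      rw [pairFilter_cons, if_pos (Or.inl rfl), idxOf_cons_self, if_neg (by omega),
        pairFilter_of_notMem ha', hb]
      rfl
    · by_cases hxb : x = b
      · subst hxb
        rw [count_cons_self] at hb
        rw [count_cons_of_ne hab.symm] at ha
        have hb' : x ∉ D := count_eq_zero.1 (by omega)
        rw [pairFilter_cons, if_pos (Or.inr rfl), idxOf_cons_self, idxOf_cons_ne _ hxa,
          if_pos (by omega), pairFilter_comm, pairFilter_of_notMem hb', ha]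
        rfl
      · rw [count_cons_of_ne hxa] at ha
        rw [count_cons_of_ne hxb] at hb
        rw [pairFilter_cons, if_neg (by tauto), ih ha hb, idxOf_cons_ne _ hxa, idxOf_cons_ne _ hxb]
        simp only [Nat.succ_lt_succ_iff]

/-- The quiver to which the powers of `w w^∨` are adapted. -/
def quiverOf (w : List (Fin m)) : DynkinQuiverA m := fun e =>
  decide ((double w).idxOf (hi e) < (double w).idxOf (lo e))

theorem revProduct_two_mul (k : ℕ) (w : List (Fin m)) :
    revProduct (2 * k) w = (replicate k (double w)).flatten := by
  induction k with
  | zero => rfl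
  | succ k ih =>
    rw [show 2 * (k + 1) = 2 * k + 1 + 1 by ring, revProduct_succ, revProduct_succ, ih,
      replicate_succ', flatten_append, flatten_singleton, double, append_assoc]
    congr 2
    · rw [(funext fun i => iterate_rev_of_even (by simp) i : (Fin.rev : Fin m → Fin m)^[2 * k] = id),
        map_id]
    · rw [(funext fun i => iterate_rev_of_odd ⟨k, rfl⟩ i :
        (Fin.rev : Fin m → Fin m)^[2 * k + 1] = Fin.rev)]

theorem isChain_replicate_pair {x y : Fin m} (h : x ≠ y) (k : ℕ) :
    IsChain (· ≠ ·) (y :: (replicate k [x, y]).flatten) := by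
  induction k with
  | zero => simp
  | succ k ih =>
    rw [replicate_succ, flatten_cons]
    exact isChain_cons_cons.2 ⟨h.symm, isChain_cons_cons.2 ⟨h, ih⟩⟩

/-- Each letter occurs once in `w w^∨`, so on every edge the powers of `w w^∨` alternate between the
endpoints. An odd number of twists is a prefix of such a power. -/
theorem IsHalfWord.isAdapted (hw : IsHalfWord w) (k : ℕ) :
    (quiverOf w).IsAdapted (revProduct (2 * k + 1) w) := by
  rw [isAdapted_iff]
  intro e
  have h1 : pairFilter (lo e) (hi e) (revProduct (2 * (k + 1)) w) =
      (replicate (k + 1) (pairFilter (lo e) (hi e) (double w))).flatten := by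
    rw [revProduct_two_mul, pairFilter, filter_flatten, map_replicate]
    rfl
  rw [pairFilter_of_count_eq_one (lo_ne_hi e) (hw.count_double _) (hw.count_double _)] at h1
  have h2 : IsChain (· ≠ ·)
      (src (quiverOf w) e :: pairFilter (lo e) (hi e) (revProduct (2 * (k + 1)) w)) := by
    rw [h1, src, quiverOf]
    by_cases h : (double w).idxOf (hi e) < (double w).idxOf (lo e)
    · simp only [h, decide_true, if_true]
      exact isChain_replicate_pair (lo_ne_hi e).symm _
    · simp only [h, decide_false, if_false, Bool.false_eq_true]
      exact isChain_replicate_pair (lo_ne_hi e) _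
  rw [show 2 * (k + 1) = 2 * k + 1 + 1 by ring, revProduct_succ, pairFilter_append,
    ← cons_append] at h2
  exact h2.left_of_append

theorem quiverOf_eq_true_iff (w : List (Fin m)) (e : Fin (m - 1)) : quiverOf w e = true ↔
    (lo e ∈ w ∧ hi e ∈ w ∧ w.idxOf (hi e) < w.idxOf (lo e)) ∨ (lo e ∉ w ∧ hi e ∈ w) ∨
    (lo e ∉ w ∧ hi e ∉ w ∧ w.idxOf (hi e).rev < w.idxOf (lo e).rev) := by
  rw [quiverOf, decide_eq_true_eq, idxOf_double, idxOf_double]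
  by_cases h1 : lo e ∈ w <;> by_cases h2 : hi e ∈ w
  · simp [h1, h2]
  · have := idxOf_lt_length_of_mem h1
    simp [h1, h2]; omega
  · have := idxOf_lt_length_of_mem h2
    simp [h1, h2]; omega
  · simp [h1, h2]

end half

/-! ### Drift: the signed number of arrows between mirror vertices -/

section drift

variable {n : ℕ}

/-- The sign of an edge: `1` for an arrow to the left, `-1` for an arrow to the right. -/
def eps (Q : DynkinQuiverA (2 * n)) (k : ℕ) : ℤ :=
  if h : k < 2 * n - 1 then (if Q ⟨k, h⟩ then -1 else 1) else 0

/-- The sum of the signs of the edges between the vertices `i` and `2n - 1 - i`. -/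
def drift (Q : DynkinQuiverA (2 * n)) (i : ℕ) : ℤ := ∑ k ∈ Finset.Ico i (2 * n - 1 - i), eps Q k

theorem eps_eq_or (Q : DynkinQuiverA (2 * n)) {k : ℕ} (hk : k < 2 * n - 1) :
    eps Q k = 1 ∨ eps Q k = -1 := by
  rw [eps, dif_pos hk]
  split_ifs <;> simp

theorem eps_eq_neg_one_iff (Q : DynkinQuiverA (2 * n)) {k : ℕ} (hk : k < 2 * n - 1) :
    eps Q k = -1 ↔ Q ⟨k, hk⟩ = true := by
  rw [eps, dif_pos hk]
  split_ifs with h <;> simp [h]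

theorem drift_middle (Q : DynkinQuiverA (2 * n)) (hn : 1 ≤ n) : drift Q (n - 1) = eps Q (n - 1) := by
  rw [drift, show 2 * n - 1 - (n - 1) = n - 1 + 1 by omega, Nat.Ico_succ_singleton,
    Finset.sum_singleton]

theorem drift_succ (Q : DynkinQuiverA (2 * n)) {i : ℕ} (hi : i + 1 < n) :
    drift Q i = drift Q (i + 1) + eps Q i + eps Q (2 * n - 2 - i) := by
  rw [drift, show 2 * n - 1 - i = 2 * n - 2 - i + 1 by omega, Finset.sum_Ico_succ_top (by omega),
    Finset.sum_eq_sum_Ico_succ_bot (by omega), drift,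
    show 2 * n - 1 - (i + 1) = 2 * n - 2 - i by omega]
  ring

theorem arrowsToward_sub (Q : DynkinQuiverA (2 * n)) {i : Fin (2 * n)} (hi : i.val < n) :
    (Q.arrowsToward i i.rev : ℤ) - Q.arrowsToward i.rev i = drift Q i := by
  have h1 : drift Q i = ∑ k ∈ Finset.range (2 * n - 1),
      if i.val ≤ k ∧ k < 2 * n - 1 - i.val then eps Q k else 0 := by
    rw [drift, ← Finset.sum_filter]
    congr 1
    ext k
    simp only [Finset.mem_Ico, Finset.mem_filter, Finset.mem_range]
    omega
  rw [h1, Finset.sum_range, arrowsToward, arrowsToward, Finset.card_filter, Finset.card_filter]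
  push_cast
  rw [← Finset.sum_sub_distrib]
  refine Finset.sum_congr rfl fun e _ => ?_
  rw [eps, dif_pos e.isLt]
  simp only [Fin.val_rev, Fin.eta]
  have hlt := e.isLt
  have e1 : (i.val ≤ e.val ∧ e.val < 2 * n - (i.val + 1) ∧ Q e = false ∨
      2 * n - (i.val + 1) ≤ e.val ∧ e.val < i.val ∧ Q e = true) ↔
      ((i.val ≤ e.val ∧ e.val < 2 * n - 1 - i.val) ∧ Q e = false) := by
    constructor
    · rintro (⟨h1, h2, h3⟩ | ⟨h1, h2, h3⟩)
      · exact ⟨⟨h1, by omega⟩, h3⟩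
      · omega
    · rintro ⟨⟨h1, h2⟩, h3⟩
      exact Or.inl ⟨h1, by omega, h3⟩
  have e2 : (2 * n - (i.val + 1) ≤ e.val ∧ e.val < i.val ∧ Q e = false ∨
      i.val ≤ e.val ∧ e.val < 2 * n - (i.val + 1) ∧ Q e = true) ↔
      ((i.val ≤ e.val ∧ e.val < 2 * n - 1 - i.val) ∧ Q e = true) := by
    constructor
    · rintro (⟨h1, h2, h3⟩ | ⟨h1, h2, h3⟩)
      · omega
      · exact ⟨⟨h1, by omega⟩, h3⟩
    · rintro ⟨⟨h1, h2⟩, h3⟩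
      exact Or.inr ⟨h1, by omega, h3⟩
  simp only [e1, e2]
  by_cases h : i.val ≤ e.val ∧ e.val < 2 * n - 1 - i.val
  · cases hQ : Q e <;> simp [h]
  · simp [h]

theorem mem_balanced_iff (Q : DynkinQuiverA (2 * n)) :
    Q ∈ balanced n ↔ ∀ i < n, drift Q i = 1 ∨ drift Q i = -1 := by
  change (∀ i : Fin (2 * n), _) ↔ _
  constructor
  · intro h i hi
    have := h ⟨i, by omega⟩
    rw [arrowsToward_sub Q (by simpa using hi)] at this
    exact eq_or_eq_neg_of_abs_eq this
  · intro h i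
    by_cases hi : i.val < n
    · rw [arrowsToward_sub Q hi]
      exact abs_eq (by norm_num) |>.2 (h i hi)
    · have hi' : i.rev.val < n := by rw [Fin.val_rev]; omega
      have h1 := arrowsToward_sub Q hi'
      rw [Fin.rev_rev] at h1
      rw [abs_sub_comm, h1]
      exact abs_eq (by norm_num) |>.2 (h _ hi')

/-- If `a` and `b` are both in `w` or both outside it, the mirror edges compare the same two letters
in opposite roles and their signs cancel. If exactly one is in `w`, it precedes the other on one
edge and the reverse of the other precedes its reverse on the mirror edge, so the signs agree. -/
theorem eps_add_eps_rev {w : List (Fin (2 * n))} (hw : IsHalfWord w) {i : ℕ} (hi : i + 1 < n)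
    {a b : Fin (2 * n)} (ha : a.val = i) (hb : b.val = i + 1) :
    eps (quiverOf w) i + eps (quiverOf w) (2 * n - 2 - i) =
      (if a ∈ w then 1 else -1) - (if b ∈ w then 1 else -1) := by
  have h1 : i < 2 * n - 1 := by omega
  have h2 : 2 * n - 2 - i < 2 * n - 1 := by omega
  have r1 := eps_eq_neg_one_iff (quiverOf w) h1
  have r2 := eps_eq_neg_one_iff (quiverOf w) h2
  have o1 := eps_eq_or (quiverOf w) h1
  have o2 := eps_eq_or (quiverOf w) h2
  rw [quiverOf_eq_true_iff] at r1 r2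
  have l1 : lo (⟨i, h1⟩ : Fin (2 * n - 1)) = a := Fin.ext ha.symm
  have l2 : TypeA.hi (⟨i, h1⟩ : Fin (2 * n - 1)) = b := Fin.ext hb.symm
  have l3 : lo (⟨2 * n - 2 - i, h2⟩ : Fin (2 * n - 1)) = b.rev := by
    ext; rw [Fin.val_rev]; simp only [lo]; omega
  have l4 : TypeA.hi (⟨2 * n - 2 - i, h2⟩ : Fin (2 * n - 1)) = a.rev := by
    ext; rw [Fin.val_rev]; simp only [TypeA.hi]; omega
  rw [l1, l2] at r1
  rw [l3, l4] at r2
  simp only [hw.rev_mem_iff, Fin.rev_rev, not_not] at r2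
  have hab : a ≠ b := by rw [ne_eq, Fin.ext_iff]; omega
  by_cases h3 : a ∈ w <;> by_cases h4 : b ∈ w <;> simp only [h3, h4, true_and, false_and,
    not_true, not_false_iff, or_false, false_or, if_true, if_false, iff_true, iff_false] at r1 r2 ⊢
  · have hne : w.idxOf a ≠ w.idxOf b := fun h => hab ((idxOf_inj h3).1 h)
    rcases o1 with o1 | o1 <;> rcases o2 with o2 | o2 <;> rw [o1, o2] <;> rw [o1] at r1 <;>
      rw [o2] at r2 <;> norm_num at r1 r2 ⊢ <;> omega
  · omega
  · omega
  · have hne : w.idxOf a.rev ≠ w.idxOf b.rev := fun h =>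
      hab (Fin.rev_injective ((idxOf_inj ((hw.rev_mem_iff a).2 h3)).1 h))
    rcases o1 with o1 | o1 <;> rcases o2 with o2 | o2 <;> rw [o1, o2] <;> rw [o1] at r1 <;>
      rw [o2] at r2 <;> norm_num at r1 r2 ⊢ <;> omega

/-- At the middle edge, the one of `a`, `a.rev` lying in `w` comes first in `w w^∨`. Going outwards,
the sums over mirror edges telescope. -/
theorem drift_quiverOf {w : List (Fin (2 * n))} (hw : IsHalfWord w) {a : Fin (2 * n)}
    (ha : a.val < n) : drift (quiverOf w) a = if a ∈ w then 1 else -1 := by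
  obtain ⟨d, hd⟩ : ∃ d, a.val + d + 1 = n := ⟨n - a.val - 1, by omega⟩
  induction d generalizing a with
  | zero =>
    have h1 : n - 1 < 2 * n - 1 := by omega
    rw [show a.val = n - 1 by omega, drift_middle _ (by omega)]
    have r1 := eps_eq_neg_one_iff (quiverOf w) h1
    have o1 := eps_eq_or (quiverOf w) h1
    rw [quiverOf_eq_true_iff] at r1
    have l1 : lo (⟨n - 1, h1⟩ : Fin (2 * n - 1)) = a := by ext; simp only [lo]; omega
    have l2 : TypeA.hi (⟨n - 1, h1⟩ : Fin (2 * n - 1)) = a.rev := by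
      ext; rw [Fin.val_rev]; simp only [TypeA.hi]; omega
    rw [l1, l2] at r1
    simp only [hw.rev_mem_iff] at r1
    by_cases h3 : a ∈ w <;> simp [h3] at r1 ⊢
    · exact o1.resolve_right r1
    · exact r1
  | succ d ih =>
    have h1 := ih (a := ⟨a + 1, by omega⟩) (by simp only; omega) (by simp only; omega)
    have h2 := eps_add_eps_rev hw (i := a) (by omega) (a := a) (b := ⟨a + 1, by omega⟩) rfl rfl
    simp only at h1
    rw [drift_succ _ (by omega), h1, add_assoc, h2]
    ring

theorem quiverOf_mem_balanced {w : List (Fin (2 * n))} (hw : IsHalfWord w) :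
    quiverOf w ∈ balanced n := by
  rw [mem_balanced_iff]
  intro i hi
  have := drift_quiverOf hw (a := ⟨i, by omega⟩) hi
  simp only at this
  rw [this]
  split_ifs <;> simp

theorem mem_iff_of_quiverOf_eq {w w' : List (Fin (2 * n))} (hw : IsHalfWord w)
    (hw' : IsHalfWord w') (h : quiverOf w = quiverOf w') (a : Fin (2 * n)) : a ∈ w ↔ a ∈ w' := by
  have key : ∀ a : Fin (2 * n), a.val < n → (a ∈ w ↔ a ∈ w') := by
    intro a ha
    have h1 := drift_quiverOf hw ha
    rw [h, drift_quiverOf hw' ha] at h1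
    split_ifs at h1 with h2 h3 h3 <;> simp_all
  by_cases ha : a.val < n
  · exact key a ha
  · have := key a.rev (by rw [Fin.val_rev]; omega)
    rw [hw.rev_mem_iff, hw'.rev_mem_iff] at this
    exact not_iff_not.1 this

/-- A half word is determined up to commutation by its quiver. -/
theorem commEqv_of_quiverOf_eq {w w' : List (Fin (2 * n))} (hw : IsHalfWord w)
    (hw' : IsHalfWord w') (h : quiverOf w = quiverOf w') : CommEqv w w' := by
  have hmem := mem_iff_of_quiverOf_eq hw hw' h
  have hcount : ∀ a, w.count a = w'.count a := by
    intro a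
    by_cases ha : a ∈ w
    · rw [hw.count_eq_one ha, hw'.count_eq_one ((hmem a).1 ha)]
    · rw [count_eq_zero.2 ha, count_eq_zero.2 fun h => ha ((hmem a).2 h)]
  have hedge : ∀ e, pairFilter (lo e) (hi e) w = pairFilter (lo e) (hi e) w' := by
    intro e
    by_cases h1 : lo e ∈ w
    · by_cases h2 : hi e ∈ w
      · have h3 := quiverOf_eq_true_iff w e
        rw [h, quiverOf_eq_true_iff] at h3
        simp only [h1, h2, (hmem _).1 h1, (hmem _).1 h2, true_and, not_true, false_and,
          or_false] at h3
        rw [pairFilter_of_count_eq_one (lo_ne_hi e) (hw.count_eq_one h1) (hw.count_eq_one h2),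
          pairFilter_of_count_eq_one (lo_ne_hi e) (hw'.count_eq_one ((hmem _).1 h1))
            (hw'.count_eq_one ((hmem _).1 h2))]
        simp only [h3]
      · rw [pairFilter_comm, pairFilter_of_notMem h2, pairFilter_comm (lo e),
          pairFilter_of_notMem (fun h => h2 ((hmem _).2 h)), hcount]
    · rw [pairFilter_of_notMem h1, pairFilter_of_notMem (fun h => h1 ((hmem _).2 h)), hcount]
  refine commEqv_of_pairFilter_eq fun a b hab => ?_
  by_cases hne : a = b
  · subst hne
    have : ∀ l : List (Fin (2 * n)), pairFilter a a l = replicate (l.count a) a := by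
      intro l
      rw [← filter_beq, pairFilter]
      exact filter_congr fun x _ => by rw [Bool.eq_iff_iff]; simp
    rw [this, this, hcount]
  · obtain ⟨e, ⟨rfl, rfl⟩ | ⟨rfl, rfl⟩⟩ := exists_edge hne hab
    · exact hedge e
    · rw [pairFilter_comm, hedge e, pairFilter_comm]

end drift

end TypeA

/-! ### Every balanced quiver comes from a half word -/

namespace TypeA

open List DynkinQuiverA

section existence

variable {n : ℕ}

/-- Consecutive drifts determine the sum of two mirror signs. A nonzero sum is `2` or `-2` and
determines both; a zero sum leaves one sign free, which is what `he` supplies. -/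
theorem eq_of_drift_eq {Q Q' : DynkinQuiverA (2 * n)} (hn : 1 ≤ n)
    (hd : ∀ i < n, drift Q i = drift Q' i)
    (he : ∀ i, i + 1 < n → drift Q i = drift Q (i + 1) → eps Q i = eps Q' i) : Q = Q' := by
  have he' : ∀ i, i + 1 < n → eps Q i = eps Q' i := by
    intro i hi
    by_cases h : drift Q i = drift Q (i + 1)
    · exact he i hi h
    · have h1 := drift_succ Q hi
      have h2 := drift_succ Q' hi
      have h3 := hd i (by omega)
      have h4 := hd (i + 1) hi
      have o1 := eps_eq_or Q (k := i) (by omega)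
      have o2 := eps_eq_or Q' (k := i) (by omega)
      have o3 := eps_eq_or Q (k := 2 * n - 2 - i) (by omega)
      have o4 := eps_eq_or Q' (k := 2 * n - 2 - i) (by omega)
      omega
  have hall : ∀ k, k < 2 * n - 1 → eps Q k = eps Q' k := by
    intro k hk
    rcases lt_trichotomy (k + 1) n with h | h | h
    · exact he' k h
    · have := hd (n - 1) (by omega)
      rwa [drift_middle _ hn, drift_middle _ hn, show n - 1 = k by omega] at this
    · have hi : 2 * n - 2 - k + 1 < n := by omega
      have h1 := drift_succ Q hi
      have h2 := drift_succ Q' hi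
      have h3 := hd (2 * n - 2 - k) (by omega)
      have h4 := hd (2 * n - 2 - k + 1) hi
      have h5 := he' (2 * n - 2 - k) hi
      rw [show 2 * n - 2 - (2 * n - 2 - k) = k by omega] at h1 h2
      omega
  funext e
  have h := hall e e.isLt
  rw [Bool.eq_iff_iff, ← eps_eq_neg_one_iff Q e.isLt, ← eps_eq_neg_one_iff Q' e.isLt, h]

/-- The letter chosen by a balanced quiver from the orbit with index `d`. -/
def orbitLetter (hn : 1 ≤ n) (Q : DynkinQuiverA (2 * n)) (d : ℕ) : Fin (2 * n) :=
  ⟨if drift Q (n - (d + 1)) = 1 then n - (d + 1) else 2 * n - 1 - (n - (d + 1)),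
    by split_ifs <;> omega⟩

/-- A half word on the innermost `d` orbits, with order given by the quiver `Q`. -/
def halfWordOf (hn : 1 ≤ n) (Q : DynkinQuiverA (2 * n)) : ℕ → List (Fin (2 * n))
  | 0 => []
  | d + 1 =>
    if eps Q (n - (d + 1)) = 1 then orbitLetter hn Q d :: halfWordOf hn Q d
    else halfWordOf hn Q d ++ [orbitLetter hn Q d]

variable {hn : 1 ≤ n} {Q : DynkinQuiverA (2 * n)} {d : ℕ}

theorem halfWordOf_perm :
    (halfWordOf hn Q (d + 1)).Perm (orbitLetter hn Q d :: halfWordOf hn Q d) := by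
  rw [halfWordOf]
  split_ifs
  · exact Perm.refl _
  · exact perm_append_singleton _ _

theorem count_halfWordOf (hd : d ≤ n) (a : Fin (2 * n)) :
    (halfWordOf hn Q d).count a + (halfWordOf hn Q d).count a.rev =
      if n ≤ a.val + d ∧ a.val < n + d then 1 else 0 := by
  induction d with
  | zero =>
    rw [if_neg (by omega)]
    rfl
  | succ d ih =>
    have h := ih (by omega)
    rw [halfWordOf_perm.count_eq, halfWordOf_perm.count_eq, count_cons, count_cons]
    simp only [beq_iff_eq, Fin.ext_iff, Fin.val_rev, orbitLetter]
    have := a.isLt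
    split_ifs at h ⊢ <;> omega

theorem isHalfWord_halfWordOf : IsHalfWord (halfWordOf hn Q n) := by
  intro a
  rw [count_halfWordOf le_rfl, if_pos (by omega)]

theorem orbitLetter_mem {k : ℕ} (hk : k < d) : orbitLetter hn Q k ∈ halfWordOf hn Q d := by
  induction d with
  | zero => omega
  | succ d ih =>
    rw [halfWordOf_perm.mem_iff, mem_cons]
    rcases Nat.lt_succ_iff_lt_or_eq.1 hk with h | rfl
    · exact Or.inr (ih h)
    · exact Or.inl rfl

theorem orbitLetter_notMem (hd : d + 1 ≤ n) : orbitLetter hn Q d ∉ halfWordOf hn Q d := by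
  intro h
  have h1 := count_halfWordOf (hn := hn) (Q := Q) (d := d) (by omega) (orbitLetter hn Q d)
  rw [← count_pos_iff] at h
  rw [if_neg] at h1
  · omega
  · simp only [orbitLetter]
    split_ifs <;> omega

/-- Later letters are added only at the two ends, so the relative order of two letters is settled
once the outer one has been inserted. -/
theorem idxOf_orbitLetter_lt_iff {k : ℕ} (hk : k + 1 < d) (hd : d ≤ n) :
    (halfWordOf hn Q d).idxOf (orbitLetter hn Q k) <
      (halfWordOf hn Q d).idxOf (orbitLetter hn Q (k + 1)) ↔ eps Q (n - (k + 2)) ≠ 1 := by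
  induction d with
  | zero => omega
  | succ d ih =>
    have hkd : orbitLetter hn Q k ∈ halfWordOf hn Q d := orbitLetter_mem (by omega)
    have hdd : orbitLetter hn Q d ∉ halfWordOf hn Q d := orbitLetter_notMem hd
    rcases Nat.lt_succ_iff_lt_or_eq.1 hk with h | h
    · rw [← ih h (by omega), halfWordOf]
      have hk1 : orbitLetter hn Q (k + 1) ∈ halfWordOf hn Q d := orbitLetter_mem h
      split_ifs
      · rw [idxOf_cons_ne _ fun h' => hdd (by rw [h']; exact hkd),
          idxOf_cons_ne _ fun h' => hdd (by rw [h']; exact hk1), Nat.succ_lt_succ_iff]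
      · rw [idxOf_append_of_mem hkd, idxOf_append_of_mem hk1]
    · subst h
      rw [halfWordOf]
      split_ifs with h1
      · simp [h1]
      · rw [idxOf_append_of_mem hkd, idxOf_append_of_notMem hdd]
        have := idxOf_lt_length_of_mem hkd
        simp only [h1, ne_eq, not_false_eq_true, iff_true]
        omega

theorem mem_halfWordOf_iff {a : Fin (2 * n)} (ha : a.val < n) :
    a ∈ halfWordOf hn Q n ↔ drift Q a = 1 := by
  have h := orbitLetter_mem (hn := hn) (Q := Q) (k := n - 1 - a.val) (d := n) (by omega)
  by_cases hd : drift Q a = 1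
  · have : orbitLetter hn Q (n - 1 - a.val) = a := by
      ext
      simp only [orbitLetter, show n - (n - 1 - a.val + 1) = a.val by omega, if_pos hd]
    simpa [hd, this] using h
  · have : orbitLetter hn Q (n - 1 - a.val) = a.rev := by
      ext
      simp only [orbitLetter, show n - (n - 1 - a.val + 1) = a.val by omega, if_neg hd, Fin.val_rev]
      omega
    rw [this, isHalfWord_halfWordOf.rev_mem_iff] at h
    simp [hd, h]

/-- The letters were chosen to reproduce the drifts. Only edges between vertices of equal drift
remain to be compared; there both chosen letters lie on the same side and their order was read off
from that edge. -/
theorem quiverOf_halfWordOf (hQ : Q ∈ balanced n) : quiverOf (halfWordOf hn Q n) = Q := by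
  rw [mem_balanced_iff] at hQ
  have hw : IsHalfWord (halfWordOf hn Q n) := isHalfWord_halfWordOf
  have hdrift : ∀ i < n, drift (quiverOf (halfWordOf hn Q n)) i = drift Q i := by
    intro i hi
    have h1 := drift_quiverOf hw (a := ⟨i, by omega⟩) hi
    have h2 := mem_halfWordOf_iff (hn := hn) (Q := Q) (a := ⟨i, by omega⟩) hi
    simp only at h1 h2
    rcases hQ i hi with h | h
    · rw [h1, if_pos (h2.2 h), h]
    · rw [h1, if_neg (fun h' => by rw [h2.1 h'] at h; norm_num at h), h]
  refine eq_of_drift_eq hn hdrift fun i hi heq => ?_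
  rw [hdrift i (by omega), hdrift (i + 1) hi] at heq
  have hlt : i < 2 * n - 1 := by omega
  have o1 := eps_eq_or (quiverOf (halfWordOf hn Q n)) hlt
  have o2 := eps_eq_or Q hlt
  suffices h : eps (quiverOf (halfWordOf hn Q n)) i = -1 ↔ eps Q i ≠ 1 by
    rcases o1 with o1 | o1 <;> rcases o2 with o2 | o2 <;> rw [o1, o2] at h ⊢ <;> norm_num at h
  have hidx := idxOf_orbitLetter_lt_iff (hn := hn) (Q := Q) (k := n - (i + 2)) (d := n)
    (by omega) le_rfl
  rw [show n - (n - (i + 2) + 2) = i by omega] at hidx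
  rw [← hidx, eps_eq_neg_one_iff _ hlt, quiverOf_eq_true_iff]
  have l1 : lo (⟨i, hlt⟩ : Fin (2 * n - 1)) = ⟨i, by omega⟩ := rfl
  have l2 : TypeA.hi (⟨i, hlt⟩ : Fin (2 * n - 1)) = ⟨i + 1, by omega⟩ := rfl
  rw [l1, l2, mem_halfWordOf_iff (by simp only; omega), mem_halfWordOf_iff (by simp only; omega)]
  simp only [← heq]
  by_cases h : drift Q i = 1
  · have e1 : orbitLetter hn Q (n - (i + 2)) = ⟨i + 1, by omega⟩ := by
      ext
      simp only [orbitLetter, show n - (n - (i + 2) + 1) = i + 1 by omega, ← heq, if_pos h]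
    have e2 : orbitLetter hn Q (n - (i + 2) + 1) = ⟨i, by omega⟩ := by
      ext
      simp only [orbitLetter, show n - (n - (i + 2) + 1 + 1) = i by omega, if_pos h]
    rw [e1, e2]
    simp [h]
  · have e1 : orbitLetter hn Q (n - (i + 2)) = (⟨i + 1, by omega⟩ : Fin (2 * n)).rev := by
      ext
      simp only [orbitLetter, show n - (n - (i + 2) + 1) = i + 1 by omega, ← heq, if_neg h,
        Fin.val_rev]
      omega
    have e2 : orbitLetter hn Q (n - (i + 2) + 1) = (⟨i, by omega⟩ : Fin (2 * n)).rev := by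
      ext
      simp only [orbitLetter, show n - (n - (i + 2) + 1 + 1) = i by omega, if_neg h, Fin.val_rev]
      omega
    rw [e1, e2]
    simp [h]

end existence

/-! ### The fibres of folding -/

section twisted

variable {n : ℕ}

theorem orbCount_eq_count_add {m : ℕ} {a : Fin m} (ha : a ≠ a.rev) (w : List (Fin m)) :
    orbCount a w = w.count a + w.count a.rev := by
  induction w with
  | nil => rfl
  | cons x w ih =>
    rw [orbCount_cons, ih, count_cons, count_cons]
    simp only [beq_iff_eq]
    by_cases h1 : x = a
    · subst h1; simp [ha]; omega
    · by_cases h2 : x = a.rev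
      · subst h2; simp [ha.symm]; omega
      · simp [h1, h2]

theorem succAbove_ne_rev (i : Fin (2 * n)) :
    (centre n).succAbove i ≠ ((centre n).succAbove i).rev := by
  rw [ne_eq, Fin.ext_iff, Fin.val_rev, val_succAbove_centre]
  have := i.isLt
  split_ifs <;> omega

theorem _root_.IsTwistedCoxeterWord.isHalfWord {w : List (Fin (2 * n + 1))}
    (hw : IsTwistedCoxeterWord n w) : IsHalfWord (foldWord n w) := by
  intro i
  rw [count_foldWord, count_foldWord, ← rev_succAbove_centre,
    ← orbCount_eq_count_add (succAbove_ne_rev i), hw.orbCount_eq]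

theorem isTwistedCoxeterWord_of_perm {w : List (Fin (2 * n))} (hw : IsHalfWord w)
    {η : List (Fin (2 * n + 1))} (hη : η.Perm (centre n :: w.map (centre n).succAbove)) :
    IsTwistedCoxeterWord n η := by
  intro a
  rw [hη.countP_eq]
  change orbCount a _ = 1
  rcases Fin.eq_self_or_eq_succAbove (centre n) a with rfl | ⟨i, rfl⟩
  · rw [orbCount_cons, if_pos (Or.inl rfl), orbCount, countP_eq_zero.2]
    intro x hx
    obtain ⟨i, -, rfl⟩ := mem_map.1 hx
    simp [rev_centre]
  · rw [orbCount_eq_count_add (succAbove_ne_rev i), rev_succAbove_centre,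
      count_cons_of_ne (Fin.succAbove_ne _ _).symm, count_cons_of_ne (Fin.succAbove_ne _ _).symm,
      count_map_of_injective _ _ Fin.succAbove_right_injective,
      count_map_of_injective _ _ Fin.succAbove_right_injective]
    exact hw i

theorem centre_notMem_pairFilter (a b : Fin (2 * n)) (w : List (Fin (2 * n + 1))) :
    centre n ∉ pairFilter ((centre n).succAbove a) ((centre n).succAbove b) w := by
  rw [mem_pairFilter]
  rintro ⟨-, h | h⟩
  · exact (Fin.succAbove_ne _ _).symm h
  · exact (Fin.succAbove_ne _ _).symm h

/-- A twisted Coxeter word is determined up to commutation by the quiver of its image under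
folding and by its restriction to the three central letters. -/
theorem _root_.IsTwistedCoxeterWord.commEqv_of_quiverOf_eq {w w' : List (Fin (2 * n + 1))}
    (hw : IsTwistedCoxeterWord n w) (hw' : IsTwistedCoxeterWord n w')
    (hQ : quiverOf (foldWord n w) = quiverOf (foldWord n w'))
    (ht : triFilter n w = triFilter n w') : CommEqv w w' := by
  have hfold := TypeA.commEqv_of_quiverOf_eq hw.isHalfWord hw'.isHalfWord hQ
  refine commEqv_of_pairFilter_eq fun x y hxy => ?_
  have htri : (n ≤ x.val + 1 ∧ x.val ≤ n + 1) → (n ≤ y.val + 1 ∧ y.val ≤ n + 1) →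
      pairFilter x y w = pairFilter x y w' := fun hx hy => by
    rw [← pairFilter_triFilter hx hy, ht, pairFilter_triFilter hx hy]
  rw [ne_eq, A_eq_two_iff] at hxy
  rcases Fin.eq_self_or_eq_succAbove (centre n) x with rfl | ⟨a, rfl⟩
  · have hc : (centre n).val = n := rfl
    exact htri (by omega) (by omega)
  · rcases Fin.eq_self_or_eq_succAbove (centre n) y with rfl | ⟨b, rfl⟩
    · have hc : (centre n).val = n := rfl
      exact htri (by omega) (by omega)
    · have hab : CoxeterMatrix.A (2 * n) a b ≠ 2 := by
        rw [ne_eq, A_eq_two_iff]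
        rw [val_succAbove_centre, val_succAbove_centre] at hxy
        split_ifs at hxy <;> omega
      have h := hfold.pairFilter_eq hab
      rw [pairFilter_foldWord, pairFilter_foldWord] at h
      rw [← map_succAbove_foldWord (centre_notMem_pairFilter a b w), h,
        map_succAbove_foldWord (centre_notMem_pairFilter a b w')]

theorem _root_.IsTwistedCoxeterWord.foldWord_mem_adaptedClass {w : List (Fin (2 * n + 1))}
    (hw : IsTwistedCoxeterWord n w) :
    foldWord n (twistedProduct n w) ∈ (quiverOf (foldWord n w)).adaptedClass := by
  refine ⟨hw.isReducedWordOfLongest_foldWord, ?_⟩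
  rw [twistedProduct_eq, foldWord_revProduct]
  exact hw.isHalfWord.isAdapted n

/-- All terms of the union coincide, by the rigidity of the central letters. -/
theorem _root_.IsTwistedCoxeterWord.foldClass_eq {w : List (Fin (2 * n + 1))} (hn : 1 ≤ n)
    (hw : IsTwistedCoxeterWord n w) :
    foldClass n (commClass (twistedProduct n w)) = (quiverOf (foldWord n w)).adaptedClass := by
  rw [← commClass_eq_adaptedClass hw.foldWord_mem_adaptedClass]
  have key : ∀ ω ∈ commClass (twistedProduct n w),
      commClass (foldWord n ω) = commClass (foldWord n (twistedProduct n w)) := fun ω hω =>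
    commClass_eq_iff.2 (hw.commEqv_foldWord hn hω).symm'
  rw [foldClass, Set.iUnion₂_congr key]
  exact Set.biUnion_const ⟨_, CommEqv.rfl'⟩ _

theorem mem_foldWord_iff (i : Fin (2 * n)) (w : List (Fin (2 * n + 1))) :
    i ∈ foldWord n w ↔ (centre n).succAbove i ∈ w := by
  rw [← count_pos_iff, count_foldWord, count_pos_iff]

/-- Words with the same quiver have the same central neighbour of the centre. -/
theorem centralNeighbour_unique {w w' : List (Fin (2 * n + 1))}
    (hw : IsTwistedCoxeterWord n w) (hw' : IsTwistedCoxeterWord n w')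
    (hQ : quiverOf (foldWord n w) = quiverOf (foldWord n w')) {x y : Fin (2 * n + 1)}
    (hx : x.val + 1 = n ∨ x.val = n + 1) (hy : y.val + 1 = n ∨ y.val = n + 1) (hxw : x ∈ w)
    (hyw : y ∈ w') : x = y := by
  have hmem := mem_iff_of_quiverOf_eq hw.isHalfWord hw'.isHalfWord hQ
  rcases Fin.eq_self_or_eq_succAbove (centre n) x with rfl | ⟨a, rfl⟩
  · simp only [centre] at hx; omega
  rcases Fin.eq_self_or_eq_succAbove (centre n) y with rfl | ⟨b, rfl⟩
  · simp only [centre] at hy; omega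
  rw [← mem_foldWord_iff] at hxw hyw
  rw [hmem] at hxw
  by_contra hne
  have hab : b = a.rev := by
    rw [Fin.ext_iff] at hne ⊢
    rw [val_succAbove_centre] at hx hy
    rw [val_succAbove_centre, val_succAbove_centre] at hne
    rw [Fin.val_rev]
    split_ifs at hx hy hne <;> omega
  rw [hab, hw'.isHalfWord.rev_mem_iff] at hyw
  exact hyw hxw

/-- The centre is put before or after one and the same half word; folding does not see it, while its
order relative to its neighbour differs. -/
theorem exists_twistedCoxeterWord_pair (hn : 1 ≤ n) {Q : DynkinQuiverA (2 * n)}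
    (hQ : Q ∈ balanced n) :
    ∃ w₁ w₂, IsTwistedCoxeterWord n w₁ ∧ IsTwistedCoxeterWord n w₂ ∧
      quiverOf (foldWord n w₁) = Q ∧ quiverOf (foldWord n w₂) = Q ∧
      triFilter n w₁ ≠ triFilter n w₂ := by
  set h := halfWordOf hn Q n with hh
  have hhalf : IsHalfWord h := isHalfWord_halfWordOf
  have t1 := isTwistedCoxeterWord_of_perm hhalf (Perm.refl _)
  refine ⟨centre n :: h.map (centre n).succAbove, h.map (centre n).succAbove ++ [centre n], t1,
    isTwistedCoxeterWord_of_perm hhalf (perm_append_singleton _ _), ?_, ?_, ?_⟩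
  · rw [foldWord_centre_cons, foldWord_map_succAbove, quiverOf_halfWordOf hQ]
  · rw [foldWord_append, foldWord_centre_cons, foldWord_nil, append_nil, foldWord_map_succAbove,
      quiverOf_halfWordOf hQ]
  · have e1 : triFilter n (centre n :: h.map (centre n).succAbove) =
        centre n :: triFilter n (h.map (centre n).succAbove) := by
      simp [triFilter, centre]
    have e2 : triFilter n (h.map (centre n).succAbove ++ [centre n]) =
        triFilter n (h.map (centre n).succAbove) ++ [centre n] := by
      simp [triFilter, centre]
    obtain ⟨x, hx, -, h1⟩ := t1.triFilter_eq hn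
    have hxc : x ≠ centre n := by
      rw [ne_eq, Fin.ext_iff]; simp only [centre]; omega
    have h1 := h1.resolve_right fun h1 => by
      rw [e1] at h1
      exact hxc (cons.inj h1).1.symm
    rw [e2, h1]
    rw [e1] at h1
    rw [(cons.inj h1).2]
    intro h2
    exact hxc (cons.inj h2).1.symm

/-- Equal folded classes mean equal quivers, and the quiver fixes the word up to the position of the
centre relative to its neighbour. -/
theorem ncard_fibre (hn : 1 ≤ n) {Q : DynkinQuiverA (2 * n)} (hQ : Q ∈ balanced n)
    (hinj : Set.InjOn adaptedClass (balanced n)) :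
    {C ∈ twistedCoxeterClasses n | foldClass n C = Q.adaptedClass}.ncard = 2 := by
  obtain ⟨w₁, w₂, h₁, h₂, q₁, q₂, ht⟩ := exists_twistedCoxeterWord_pair hn hQ
  rw [Set.ncard_eq_two]
  refine ⟨commClass (twistedProduct n w₁), commClass (twistedProduct n w₂), fun h => ?_, ?_⟩
  · exact ht (h₁.triFilter_eq_of_commEqv hn h₂ (commClass_eq_iff.1 h))
  ext C
  constructor
  · rintro ⟨⟨w, hw, rfl⟩, hC⟩
    rw [hw.foldClass_eq hn] at hC
    have hq := hinj (quiverOf_mem_balanced hw.isHalfWord) hQ hC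
    -- The three words share the same neighbour of the centre. Only two orders are possible, and
    -- `w₁` and `w₂` realize both.
    have key : triFilter n w = triFilter n w₁ ∨ triFilter n w = triFilter n w₂ := by
      obtain ⟨x, hx, hxw, hxt⟩ := hw.triFilter_eq hn
      obtain ⟨y, hy, hyw, hyt⟩ := h₁.triFilter_eq hn
      obtain ⟨z, hz, hzw, hzt⟩ := h₂.triFilter_eq hn
      obtain rfl := centralNeighbour_unique hw h₁ (hq.trans q₁.symm) hx hy hxw hyw
      obtain rfl := centralNeighbour_unique hw h₂ (hq.trans q₂.symm) hx hz hxw hzw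
      rcases hxt with h | h <;> rcases hyt with h' | h' <;> rcases hzt with h'' | h'' <;>
        rw [h', h''] at ht <;> rw [h, h', h''] <;> simp at ht ⊢
    have lift : ∀ w', IsTwistedCoxeterWord n w' → quiverOf (foldWord n w') = Q →
        triFilter n w = triFilter n w' →
        commClass (twistedProduct n w) = commClass (twistedProduct n w') := fun w' hw' q' ht' =>
      commClass_eq_iff.2 ((hw.commEqv_of_quiverOf_eq hw' (hq.trans q'.symm) ht').revProduct _)
    rcases key with h | h
    · exact Or.inl (lift w₁ h₁ q₁ h)
    · exact Or.inr (lift w₂ h₂ q₂ h)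
  · rintro (rfl | rfl)
    · exact ⟨⟨w₁, h₁, rfl⟩, by rw [h₁.foldClass_eq hn, q₁]⟩
    · exact ⟨⟨w₂, h₂, rfl⟩, by rw [h₂.foldClass_eq hn, q₂]⟩

theorem image_foldClass (hn : 1 ≤ n) :
    foldClass n '' twistedCoxeterClasses n = adaptedClass '' balanced n := by
  ext D
  constructor
  · rintro ⟨_, ⟨w, hw, rfl⟩, rfl⟩
    exact ⟨_, quiverOf_mem_balanced hw.isHalfWord, (hw.foldClass_eq hn).symm⟩
  · rintro ⟨Q, hQ, rfl⟩
    obtain ⟨w, -, hw, -, q, -⟩ := exists_twistedCoxeterWord_pair hn hQ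
    exact ⟨_, ⟨w, hw, rfl⟩, by rw [hw.foldClass_eq hn, q]⟩

theorem injOn_adaptedClass (hn : 1 ≤ n) :
    Set.InjOn (adaptedClass : DynkinQuiverA (2 * n) → _) (balanced n) := by
  intro Q hQ Q' _ h
  obtain ⟨w, -, hw, -, q, -⟩ := exists_twistedCoxeterWord_pair hn hQ
  have h1 := hw.foldWord_mem_adaptedClass
  rw [q] at h1
  have h2 := h1
  rw [h] at h2
  exact eq_of_adapted (mem_of_isReducedWordOfLongest h1.1) h1.2 h2.2

end twisted

/-! ### Counting balanced quivers -/

section count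

variable {n : ℕ}

/-- The code of a balanced quiver: the drift at the middle, and for each outer vertex either
`none`, if the drift changes sign there, or the direction of the outer edge. -/
def code (Q : DynkinQuiverA (2 * n)) : Bool × (Fin (n - 1) → Option Bool) :=
  (decide (drift Q (n - 1) = 1), fun j =>
    if drift Q j = drift Q (j + 1) then some (decide (eps Q j = 1)) else none)

/-- The code yields the drifts from the middle outwards, and the directions it stores are those that
the drifts leave open. -/
theorem injOn_code (hn : 1 ≤ n) : Set.InjOn code (balanced n) := by
  intro Q hQ Q' hQ' h
  rw [mem_balanced_iff] at hQ hQ'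
  obtain ⟨h1, h2⟩ := Prod.mk.inj h
  have h3 : ∀ d < n, drift Q (n - 1 - d) = drift Q' (n - 1 - d) := by
    intro d
    induction d with
    | zero =>
      intro _
      have o1 := hQ (n - 1) (by omega)
      have o2 := hQ' (n - 1) (by omega)
      rw [decide_eq_decide] at h1
      rw [Nat.sub_zero]
      omega
    | succ d ih =>
      intro hd
      have h4 := congrFun h2 ⟨n - 1 - (d + 1), by omega⟩
      simp only [show n - 1 - (d + 1) + 1 = n - 1 - d by omega] at h4
      have h5 := ih (by omega)
      have o1 := hQ (n - 1 - (d + 1)) (by omega)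
      have o2 := hQ' (n - 1 - (d + 1)) (by omega)
      have o3 := hQ (n - 1 - d) (by omega)
      split_ifs at h4 <;> omega
  have h4 : ∀ i < n, drift Q i = drift Q' i := by
    intro i hi
    have := h3 (n - 1 - i) (by omega)
    rwa [show n - 1 - (n - 1 - i) = i by omega] at this
  refine eq_of_drift_eq hn h4 fun i hi heq => ?_
  have h5 := congrFun h2 ⟨i, by omega⟩
  simp only at h5
  rw [if_pos heq, if_pos (by rw [← h4 i (by omega), ← h4 _ hi, heq]), Option.some_inj,
    decide_eq_decide] at h5
  have o1 := eps_eq_or Q (k := i) (by omega)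
  have o2 := eps_eq_or Q' (k := i) (by omega)
  omega

/-- The signs of the drift prescribed by a code, from the middle outwards. -/
def codeSign (n : ℕ) (c : Bool × (ℕ → Option Bool)) : ℕ → Bool
  | 0 => c.1
  | d + 1 => if c.2 (n - (d + 2)) = none then !(codeSign n c d) else codeSign n c d

/-- The quiver with a given code. -/
def decode (c : Bool × (ℕ → Option Bool)) : DynkinQuiverA (2 * n) := fun e =>
  if e.val + 1 = n then !c.1
  else if e.val < n then (c.2 e.val).elim (!(codeSign n c (n - 1 - e.val))) (fun b => !b)
  else (c.2 (2 * n - 2 - e.val)).elim (!(codeSign n c (n - 1 - (2 * n - 2 - e.val)))) id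

/-- For `none` both mirror edges carry the new sign, which changes the drift by two; for `some b`
their signs cancel. -/
theorem drift_decode (c : Bool × (ℕ → Option Bool)) {d : ℕ} (hd : d < n) :
    drift (decode c : DynkinQuiverA (2 * n)) (n - 1 - d) = if codeSign n c d then 1 else -1 := by
  induction d with
  | zero =>
    rw [Nat.sub_zero, drift_middle _ (by omega), eps, dif_pos (by omega), decode]
    simp only [show n - 1 + 1 = n by omega, if_true, codeSign]
    by_cases h : c.1 = true <;> simp [h]
  | succ d ih =>
    have h1 := ih (by omega)
    rw [drift_succ _ (by omega), show n - 1 - (d + 1) + 1 = n - 1 - d by omega, h1, eps,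
      dif_pos (by omega), eps, dif_pos (by omega), decode, decode]
    simp only [show n - 1 - (d + 1) + 1 ≠ n by omega, show n - 1 - (d + 1) < n by omega,
      show 2 * n - 2 - (n - 1 - (d + 1)) + 1 ≠ n by omega,
      show ¬ (2 * n - 2 - (n - 1 - (d + 1)) < n) by omega,
      show 2 * n - 2 - (2 * n - 2 - (n - 1 - (d + 1))) = n - 1 - (d + 1) by omega,
      show n - 1 - (n - 1 - (d + 1)) = d + 1 by omega, if_true, if_false, codeSign,
      show n - (d + 2) = n - 1 - (d + 1) by omega]
    cases hc : c.2 (n - 1 - (d + 1)) with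
    | none => cases codeSign n c d <;> simp
    | some b => cases codeSign n c d <;> cases b <;> simp

theorem surjOn_code (hn : 1 ≤ n) : code '' balanced n = Set.univ := by
  refine Set.eq_univ_of_forall fun ⟨s, f⟩ => ?_
  -- The value `none` outside the range is never read for these quivers: only indices below `n - 1`
  -- occur.
  set c : Bool × (ℕ → Option Bool) := (s, fun j => if h : j < n - 1 then f ⟨j, h⟩ else none)
  have hdrift : ∀ i < n, drift (decode c : DynkinQuiverA (2 * n)) i =
      if codeSign n c (n - 1 - i) then 1 else -1 := by
    intro i hi
    have := drift_decode c (d := n - 1 - i) (n := n) (by omega)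
    rwa [show n - 1 - (n - 1 - i) = i by omega] at this
  refine ⟨decode c, (mem_balanced_iff _).2 fun i hi => ?_, ?_⟩
  · rw [hdrift i hi]
    split_ifs <;> simp
  · refine Prod.ext ?_ (funext fun j => ?_)
    · simp only [code]
      rw [hdrift _ (by omega), Nat.sub_self, codeSign]
      cases s <;> simp [c]
    · have hj := j.isLt
      have hcj : c.2 j.val = f j := by simp [c]
      simp only [code]
      rw [hdrift _ (by omega), hdrift _ (by omega),
        show n - 1 - j.val = n - 1 - (j.val + 1) + 1 by omega, codeSign,
        show n - (n - 1 - (j.val + 1) + 2) = j.val by omega, hcj, eps, dif_pos (by omega), decode]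
      simp only [show j.val + 1 ≠ n by omega, show j.val < n by omega, if_true, if_false, hcj]
      cases f j with
      | none => cases codeSign n c (n - 1 - (j.val + 1)) <;> simp
      | some b => cases b <;> simp

theorem ncard_balanced (hn : 1 ≤ n) : (balanced n).ncard = 2 * 3 ^ (n - 1) := by
  rw [← (injOn_code hn).ncard_image, surjOn_code hn, Set.ncard_univ,
    Nat.card_eq_fintype_card]
  simp

end count

end TypeA

theorem mainTheorem3 (n : ℕ) (hn : 1 ≤ n) :
    (∀ ω : List (Fin (2 * n + 1)), IsTwistedCoxeterWord n ω →
      IsReducedWordOfLongest (twistedProduct n ω) ∧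
        commClass (twistedProduct n ω) ∈ twistedAdaptedCluster n) ∧
    (∀ C ∈ twistedCoxeterClasses n, ∀ ω ∈ C, commClass (foldWord n ω) = foldClass n C) ∧
    foldClass n '' twistedCoxeterClasses n =
      DynkinQuiverA.adaptedClass '' DynkinQuiverA.balanced n ∧
    (∀ Q ∈ DynkinQuiverA.balanced n,
      {C ∈ twistedCoxeterClasses n | foldClass n C = Q.adaptedClass}.ncard = 2) ∧
    Set.InjOn DynkinQuiverA.adaptedClass (DynkinQuiverA.balanced n) ∧
    (DynkinQuiverA.balanced n).ncard = 2 * 3 ^ (n - 1) := by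
  refine ⟨fun ω hω => ⟨hω.isReducedWordOfLongest, hω.mem_cluster⟩, ?_, TypeA.image_foldClass hn,
    fun Q hQ => TypeA.ncard_fibre hn hQ (TypeA.injOn_adaptedClass hn),
    TypeA.injOn_adaptedClass hn, TypeA.ncard_balanced hn⟩
  rintro _ ⟨w, hw, rfl⟩ ω hω
  rw [hw.foldClass_eq hn, ← TypeA.commClass_eq_adaptedClass hw.foldWord_mem_adaptedClass]
  exact TypeA.commClass_eq_iff.2 (hw.commEqv_foldWord hn hω).symm'
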